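/- Let $k,\ell\ge 1$ and $n\ge 0$ be integers, $[k]=\{1,\dots,k\}$, and for distributions $p,q$ on $[k]$ let $d_{TV}(p,q)=\frac12\sum_x|p(x)-q(x)|$. In an $\ell$-bit public-coin protocol with $n$ players, player $i$ holds a sample $X_i$, where $X_1,\dots,X_n$ are i.i.d. from an unknown distribution $p$ on $[k]$; a public random variable $U$, independent of the samples, is available to all players and to the referee; given $U$, player $i$ sends one message $M_i\in\{0,1\}^\ell$, a privately randomized function of $(X_i,U)$; and the referee outputs accept or reject as a randomized function of $(M_1,\dots,M_n,U)$. For a known distribution $q$ on $[k]$ the protocol is a $(k,\varepsilon)$-identity test for $q$ if it accepts with probability greater than $11/12$ when $p=q$, and rejects with probability greater than $11/12$ whenever $d_{TV}(p,q)>\varepsilon$. A balanced partition is an ordered partition into $2^\ell$ parts of equal size. **Theorem.** There is an absolute constant $C>0$ such that the following hold for all $\varepsilon>0$. 1. For all $k$ and $1\le\ell\le\lceil\log_2 k\rceil$ there is $n\le C\,\dfrac{k}{2^{\ell/2}\varepsilon^2}$ such that for every distribution $q$ on $[k]$ there is an $\ell$-bit public-coin $(k,\varepsilon)$-identity test for $q$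 with $n$ players. It can be chosen of the following form. There are $K\le Ck$ divisible by $2^\ell$ and $N\le C$; the public coins are $N$ independent uniformly random balanced partitions of $[K]$ into $2^\ell$ parts; the players are divided into $N$ blocks; and each player maps its sample to $[K]$ by a private randomized map, the same for all players and not depending on $p$, and reports which part of the partition shared by its block contains the result. 2. If $k\ge1$, $\ell\ge 1$, $2^\ell$ divides $k$ and $q$ is the uniform distribution on $[k]$, then, for some $n\le C\,\dfrac{k}{2^{\ell/2}\varepsilon^2}$ and $N\le C$, there is such a test with $n$ players in which the public coins are $N$ independent uniformly random balanced partitions of $[k]$ itself into $2^\ell$ parts, and each player reports which part of the partition shared by its block contains its sample. 3. For all $k\ge1$ and $\ell\ge1$ there is $n\le C\,\dfrac{k}{\min(2^{\ell/2},\sqrt k)\,\varepsilon^2}$ such that for every distribution $q$ on $[k]$ there is an $\ell$-bit public-coin $(k,\varepsilon)$-identity test for $q$ with $n$ players. (The value $n=0$ matters only for degenerate parameters, such as $\varepsilon\ge1$.) -/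

import Mathlib

open scoped ENNReal

noncomputable section

namespace DistTest

/-- The law of a vector of independent coordinates, the `i`-th one having law `μ i`. -/
def productPMF {n : ℕ} {α : Type} [Fintype α] (μ : Fin n → PMF α) : PMF (Fin n → α) :=
  PMF.ofFintype (fun x => ∏ i, μ i (x i)) (by
    have h := (Finset.prod_univ_sum (fun _ : Fin n => (Finset.univ : Finset α))
      (fun i a => μ i a)).symm
    rw [Fintype.piFinset_univ] at h
    rw [h]
    refine Finset.prod_eq_one fun i _ => ?_
    have h1 := (μ i).tsum_coe
    rwa [tsum_fintype] at h1)

/-- Total variation distance of two distributions on `k` points. -/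
def tvDist {k : ℕ} (p q : PMF (Fin k)) : ℝ :=
  (1 / 2) * ∑ x, |(p x).toReal - (q x).toReal|

/-- An `ℓ`-bit message. -/
abbrev Message (ℓ : ℕ) : Type := Fin ℓ → Bool

/-- An `ℓ`-bit public-coin simultaneous-message protocol with `n` players, each holding one sample
from a domain with `k` elements, and a referee with a binary output. The public coin `U` has law
`coin`. Given `U = u`, player `i` passes the sample through the channel `channel u i`, using private
randomness, and the referee, who sees `u` and all messages, follows the randomized rule
`decision u`. -/
structure PublicCoinProtocol (k ℓ n : ℕ) where
  Ω : Type
  coin : PMF Ω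
  channel : Ω → Fin n → Fin k → PMF (Message ℓ)
  decision : Ω → (Fin n → Message ℓ) → PMF Bool

namespace PublicCoinProtocol

variable {k ℓ n : ℕ}

/-- The law of the messages given the public coin `u`, for players with independent samples
from `p`. -/
def messages (P : PublicCoinProtocol k ℓ n) (p : PMF (Fin k)) (u : P.Ω) :
    PMF (Fin n → Message ℓ) :=
  (productPMF fun _ : Fin n => p).bind fun x => productPMF fun i => P.channel u i (x i)

/-- The law of the referee's output for independent samples from `p`; the public coin is
independent of the samples. The output `true` means "accept". -/
def output (P : PublicCoinProtocol k ℓ n) (p : PMF (Fin k)) : PMF Bool :=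
  P.coin.bind fun u => (P.messages p u).bind fun m => P.decision u m

/-- The protocol tests identity to `q` with distance parameter `ε` and error probability `δ`. -/
def IsIdentityTest (P : PublicCoinProtocol k ℓ n) (q : PMF (Fin k)) (ε δ : ℝ) : Prop :=
  ∀ p : PMF (Fin k),
    (p = q → 1 - δ < (P.output p true).toReal) ∧
    (ε < tvDist p q → 1 - δ < (P.output p false).toReal)

end PublicCoinProtocol

/-- Ordered partitions of a `K`-element set into `2 ^ ℓ` parts of equal size `K / 2 ^ ℓ`, the parts
being labelled by the `ℓ`-bit messages; such a partition is encoded by the map that sends an element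
to the label of its part. -/
abbrev BalancedPartition (K ℓ : ℕ) : Type :=
  {f : Fin K → Message ℓ // ∀ s, 2 ^ ℓ * (Finset.univ.filter fun j => f j = s).card = K}

theorem nonempty_balancedPartition {K ℓ : ℕ} (h : 2 ^ ℓ ∣ K) :
    Nonempty (BalancedPartition K ℓ) := by
  obtain ⟨m, rfl⟩ := h
  have e : Fin (2 ^ ℓ * m) ≃ Message ℓ × Fin m := Fintype.equivOfCardEq (by simp)
  refine ⟨⟨fun j => (e j).1, fun s => ?_⟩⟩
  have h1 : (Finset.univ.filter fun j => (e j).1 = s).card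
      = (Finset.univ.filter fun x : Message ℓ × Fin m => x.1 = s).card :=
    Finset.card_equiv e (by simp)
  have h2 : (Finset.univ.filter fun x : Message ℓ × Fin m => x.1 = s)
      = {s} ×ˢ (Finset.univ : Finset (Fin m)) := by
    ext ⟨a, b⟩; simp [eq_comm]
  rw [h1, h2]
  simp

/-- The protocol in which the public coins are `N` independent uniformly random balanced partitions
of a `K`-element set into `2 ^ ℓ` parts, player `i` belongs to the block `block i` of players and
reports the label of the part, in the partition of that block, that contains the value of a
(privately randomized) map `F` at the sample. -/
def partitionProtocol {k ℓ n N K : ℕ} (hK : 2 ^ ℓ ∣ K) (F : Fin k → PMF (Fin K))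
    (block : Fin n → Fin N)
    (decision : (Fin N → BalancedPartition K ℓ) → (Fin n → Message ℓ) → PMF Bool) :
    PublicCoinProtocol k ℓ n where
  Ω := Fin N → BalancedPartition K ℓ
  coin :=
    haveI := nonempty_balancedPartition hK
    PMF.uniformOfFintype (Fin N → BalancedPartition K ℓ)
  channel S i x := (F x).map (S (block i)).1
  decision := decision

end DistTest

end

noncomputable section

namespace DistTest

/-! A private channel turns the known `q` into the uniform law on `K` points, where `2k ≤ K ≤ 4k`,
and turns total variation distance from `q` into L1 distance from uniform
(`exists_uniformizing_channel`). By Cauchy–Schwarz a far `p` then has squared L2 distance at least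
`ε²/K` from uniform, so it remains to test uniformity in L2.

Reporting a part of a random balanced partition maps the uniform law on `K` points to the uniform
law on `L = 2^ℓ` messages. It keeps at least `1/8` of the squared L2 distance with probability at
least `1/30` (`card_le_sum_partMass_sq`). To see this, pair the points so that partners lie in
different parts, rotate one half against the other, and swap partners by independent fair coins. A
uniformly random relabelling absorbs these operations. The rotation keeps energy in the differences
of partners, and the swaps turn the vector of part masses into a random signed sum of vectors, to
which a second and fourth moment argument applies.

Within one block all messages have the same law on `L` points. Collisions between two groups of `m`
messages estimate its squared distance from uniform. Chebyshev's inequality separates `0` from `g =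
ε²/(8K)` once `m g √L` is a large constant, that is, `m` of order `K/(√L ε²)`. One hundred blocks
with independent partitions make it likely that at least one partition is good, and the referee
rejects if any block raises an alarm (`exists_uniformity_test`). -/

/-! ### Sums against product weights -/

theorem sum_pi_prod {ι α R : Type*} [Fintype ι] [DecidableEq ι] [Fintype α] [CommSemiring R]
    (g : ι → α → R) : ∑ x : ι → α, ∏ i, g i (x i) = ∏ i, ∑ a, g i a := by
  rw [Finset.prod_univ_sum, Fintype.piFinset_univ]

theorem productPMF_apply {n : ℕ} {α : Type} [Fintype α] (μ : Fin n → PMF α) (x : Fin n → α) :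
    productPMF μ x = ∏ i, μ i (x i) := rfl

theorem toReal_productPMF {n : ℕ} {α : Type} [Fintype α] (μ : Fin n → PMF α) (x : Fin n → α) :
    (productPMF μ x).toReal = ∏ i, (μ i (x i)).toReal := by
  rw [productPMF_apply, ENNReal.toReal_prod]

/-- Distributivity of products over sums. It integrates out samples and private coins together, so
the messages are independent given the public coin. -/
theorem productPMF_bind {n : ℕ} {α β : Type} [Fintype α] [Fintype β] (μ : Fin n → PMF α)
    (κ : Fin n → α → PMF β) :
    ((productPMF μ).bind fun x => productPMF fun i => κ i (x i))
      = productPMF fun i => (μ i).bind (κ i) := by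
  ext y
  simp only [PMF.bind_apply, productPMF_apply, tsum_fintype, ← Finset.prod_mul_distrib]
  exact sum_pi_prod fun i a => μ i a * κ i a (y i)

theorem toReal_bind {α β : Type*} [Fintype α] (μ : PMF α) (κ : α → PMF β) (b : β) :
    (μ.bind κ b).toReal = ∑ a, (μ a).toReal * (κ a b).toReal := by
  rw [PMF.bind_apply, tsum_fintype, ENNReal.toReal_sum]
  · simp
  · exact fun a _ => ENNReal.mul_ne_top (μ.apply_ne_top a) ((κ a).apply_ne_top b)

theorem sum_toReal {α : Type*} [Fintype α] (μ : PMF α) : ∑ a, (μ a).toReal = 1 := by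
  have h := μ.tsum_coe
  rw [tsum_fintype] at h
  rw [← ENNReal.toReal_sum fun a _ => μ.apply_ne_top a, h, ENNReal.toReal_one]

theorem toReal_map {α β : Type*} [Fintype α] [DecidableEq β] (μ : PMF α) (g : α → β) (b : β) :
    (μ.map g b).toReal = ∑ a, if g a = b then (μ a).toReal else 0 := by
  rw [← PMF.bind_pure_comp, toReal_bind]
  refine Finset.sum_congr rfl fun a _ => ?_
  by_cases h : g a = b
  · simp [h]
  · simp [h, PMF.pure_apply, Ne.symm h]

/-- Integrating out the coordinates outside the range of `e`. -/
theorem sum_marginal {ι κ α : Type*} [Fintype ι] [DecidableEq ι] [Fintype κ] [DecidableEq κ]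
    [Fintype α] [DecidableEq α] {e : κ → ι} (he : Function.Injective e) (w : ι → α → ℝ)
    (hw : ∀ i, ∑ a, w i a = 1) (f : (κ → α) → ℝ) :
    ∑ x : ι → α, (∏ i, w i (x i)) * f (x ∘ e) = ∑ y : κ → α, (∏ k, w (e k) (y k)) * f y := by
  classical
  -- By linearity `f` may be the indicator of one point `y`. That indicator is a product over the
  -- coordinates `i`, and a coordinate outside the range of `e` contributes its total weight `1`.
  have key : ∀ y : κ → α,
      ∑ x : ι → α, (∏ i, w i (x i)) * (if x ∘ e = y then 1 else 0) = ∏ k, w (e k) (y k) := by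
    intro y
    have h1 : ∀ x : ι → α, (∏ i, w i (x i)) * (if x ∘ e = y then (1 : ℝ) else 0)
        = ∏ i, w i (x i) * (if ∀ k, e k = i → x i = y k then 1 else 0) := by
      intro x
      rw [Finset.prod_mul_distrib, Finset.prod_boole]
      congr 2
      simp only [Finset.mem_univ, true_imp_iff, eq_iff_iff]
      constructor
      · rintro rfl i k rfl
        rfl
      · intro h
        funext k
        exact h _ k rfl
    rw [Finset.sum_congr rfl fun x _ => h1 x,
      sum_pi_prod fun i a => w i a * (if ∀ k, e k = i → a = y k then 1 else 0)]
    symm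
    refine Fintype.prod_of_injective e he _ _ (fun i hi => ?_) (fun k => ?_)
    · refine (Finset.sum_congr rfl fun a _ => ?_).trans (hw i)
      rw [if_pos fun k hk => absurd ⟨k, hk⟩ hi, mul_one]
    · rw [Finset.sum_eq_single (y k)]
      · rw [if_pos, mul_one]
        intro k' hk'
        rw [he hk']
      · intro a _ ha
        rw [if_neg fun h => ha (h k rfl), mul_zero]
      · simp
  calc ∑ x : ι → α, (∏ i, w i (x i)) * f (x ∘ e)
      = ∑ x : ι → α, ∑ y, (∏ i, w i (x i)) * (if x ∘ e = y then 1 else 0) * f y := by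
        refine Finset.sum_congr rfl fun x _ => ?_
        simp
    _ = ∑ y, ∑ x : ι → α, (∏ i, w i (x i)) * (if x ∘ e = y then 1 else 0) * f y :=
        Finset.sum_comm
    _ = _ := by
        refine Finset.sum_congr rfl fun y _ => ?_
        rw [← Finset.sum_mul, key]

theorem sum_prod_mul_apply {κ α : Type*} [Fintype κ] [DecidableEq κ] [Fintype α]
    (w : α → ℝ) (hw : ∑ a, w a = 1) (φ : α → ℝ) (i : κ) :
    ∑ x : κ → α, (∏ c, w (x c)) * φ (x i) = ∑ a, w a * φ a := by
  have h1 : ∀ x : κ → α, (∏ c, w (x c)) * φ (x i)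
      = ∏ c, w (x c) * (if c = i then φ (x c) else 1) := by
    intro x
    rw [Finset.prod_mul_distrib, Finset.prod_ite_eq' Finset.univ i fun c => φ (x c)]
    simp
  rw [Finset.sum_congr rfl fun x _ => h1 x,
    sum_pi_prod fun c a => w a * (if c = i then φ a else 1), Finset.prod_eq_single i]
  · simp
  · intro c _ hc
    simp [hc, hw]
  · simp

theorem sum_prod_mul_apply_apply {κ α : Type*} [Fintype κ] [DecidableEq κ] [Fintype α]
    (w : α → ℝ) (hw : ∑ a, w a = 1) (φ ψ : α → ℝ) {i j : κ} (hij : i ≠ j) :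
    ∑ x : κ → α, (∏ c, w (x c)) * (φ (x i) * ψ (x j))
      = (∑ a, w a * φ a) * ∑ a, w a * ψ a := by
  have h1 : ∀ x : κ → α, (∏ c, w (x c)) * (φ (x i) * ψ (x j))
      = ∏ c, w (x c) * ((if c = i then φ (x c) else 1) * (if c = j then ψ (x c) else 1)) := by
    intro x
    rw [Finset.prod_mul_distrib, Finset.prod_mul_distrib,
      Finset.prod_ite_eq' Finset.univ i fun c => φ (x c),
      Finset.prod_ite_eq' Finset.univ j fun c => ψ (x c)]
    simp
  rw [Finset.sum_congr rfl fun x _ => h1 x,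
    sum_pi_prod fun c a => w a * ((if c = i then φ a else 1) * (if c = j then ψ a else 1)),
    Finset.prod_eq_mul i j hij]
  · simp [hij, hij.symm]
  · rintro c _ ⟨hc, hc'⟩
    simp [hc, hc', hw]
  · simp
  · simp

theorem sum_prod_mul_sum {κ α : Type*} [Fintype κ] [DecidableEq κ] [Fintype α]
    (w : α → ℝ) (hw : ∑ a, w a = 1) (φ : α → ℝ) :
    ∑ x : κ → α, (∏ c, w (x c)) * ∑ i, φ (x i) = Fintype.card κ * ∑ a, w a * φ a := by
  simp_rw [Finset.mul_sum]
  rw [Finset.sum_comm]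
  simp_rw [sum_prod_mul_apply w hw φ]
  simp [Finset.mul_sum]

/-- The mixed second moment of two sums over independent samples. -/
theorem sum_prod_mul_sum_mul_sum {κ α : Type*} [Fintype κ] [DecidableEq κ] [Fintype α]
    (w : α → ℝ) (hw : ∑ a, w a = 1) (φ ψ : α → ℝ) :
    ∑ x : κ → α, (∏ c, w (x c)) * ((∑ i, φ (x i)) * ∑ j, ψ (x j))
      = (Fintype.card κ : ℝ) ^ 2 * ((∑ a, w a * φ a) * ∑ a, w a * ψ a)
        + Fintype.card κ
          * ((∑ a, w a * (φ a * ψ a)) - (∑ a, w a * φ a) * ∑ a, w a * ψ a) := by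
  have h1 : ∀ i j : κ, ∑ x : κ → α, (∏ c, w (x c)) * (φ (x i) * ψ (x j))
      = (∑ a, w a * φ a) * (∑ a, w a * ψ a)
        + if i = j then (∑ a, w a * (φ a * ψ a)) - (∑ a, w a * φ a) * ∑ a, w a * ψ a else 0 := by
    intro i j
    by_cases h : i = j
    · subst h
      rw [sum_prod_mul_apply w hw (fun a => φ a * ψ a) i, if_pos rfl]
      ring
    · rw [sum_prod_mul_apply_apply w hw φ ψ h, if_neg h, add_zero]
  calc _ = ∑ x : κ → α, ∑ i, ∑ j, (∏ c, w (x c)) * (φ (x i) * ψ (x j)) := by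
        refine Finset.sum_congr rfl fun x _ => ?_
        rw [Finset.sum_mul_sum, Finset.mul_sum]
        simp_rw [Finset.mul_sum]
    _ = ∑ i, ∑ j, ∑ x : κ → α, (∏ c, w (x c)) * (φ (x i) * ψ (x j)) := by
        rw [Finset.sum_comm]
        exact Finset.sum_congr rfl fun i _ => Finset.sum_comm
    _ = _ := by
        simp_rw [h1, Finset.sum_add_distrib]
        simp
        ring

/-! ### Mean and variance of the two-group collision statistic -/

section CollisionStatistic

variable {M : Type*} [Fintype M]

/-- The centred indicator of the value `s`. -/
def centredIndicator [DecidableEq M] (s a : M) : ℝ := (if a = s then 1 else 0) - (Fintype.card M : ℝ)⁻¹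

/-- The centred number of collisions between two groups of `m` samples. -/
def collisionStat [DecidableEq M] {m : ℕ} (x : Fin m ⊕ Fin m → M) : ℝ :=
  ∑ s, (∑ i, centredIndicator s (x (Sum.inl i))) * ∑ i, centredIndicator s (x (Sum.inr i))

/-- The squared Euclidean distance of a weight function to the uniform one. -/
def sqDistUniform (r : M → ℝ) : ℝ := ∑ s, (r s - (Fintype.card M : ℝ)⁻¹) ^ 2

theorem sum_mul_centredIndicator [DecidableEq M] (r : M → ℝ) (hr : ∑ s, r s = 1) (s : M) :
    ∑ a, r a * centredIndicator s a = r s - (Fintype.card M : ℝ)⁻¹ := by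
  simp [centredIndicator, mul_sub, Finset.sum_sub_distrib, ← Finset.sum_mul, hr]

theorem sum_mul_centredIndicator_mul [DecidableEq M] (r : M → ℝ) (hr : ∑ s, r s = 1) (s t : M) :
    (∑ a, r a * (centredIndicator s a * centredIndicator t a))
      - (r s - (Fintype.card M : ℝ)⁻¹) * (r t - (Fintype.card M : ℝ)⁻¹)
      = (if s = t then r s else 0) - r s * r t := by
  have h : ∀ a, r a * (centredIndicator s a * centredIndicator t a)
      = (if a = s then (if s = t then r s else 0) else 0)
        - (Fintype.card M : ℝ)⁻¹ * (if a = s then r a else 0)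
        - (Fintype.card M : ℝ)⁻¹ * (if a = t then r a else 0)
        + (Fintype.card M : ℝ)⁻¹ ^ 2 * r a := by
    intro a
    unfold centredIndicator
    by_cases h1 : a = s
    · subst h1
      by_cases h2 : a = t <;> simp [h2] <;> ring
    · by_cases h2 : a = t
      · subst h2
        simp [h1]; ring
      · simp [h1, h2]; ring
  rw [Finset.sum_congr rfl fun a _ => h a, Finset.sum_add_distrib, Finset.sum_sub_distrib,
    Finset.sum_sub_distrib, ← Finset.mul_sum, ← Finset.mul_sum, ← Finset.mul_sum, hr]
  simp only [Finset.sum_ite_eq', Finset.mem_univ, if_true]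
  ring

theorem sum_prod_sumType {m : ℕ} (r : M → ℝ) (F : (Fin m → M) → (Fin m → M) → ℝ) :
    ∑ x : Fin m ⊕ Fin m → M, (∏ c, r (x c)) * F (x ∘ Sum.inl) (x ∘ Sum.inr)
      = ∑ y : Fin m → M, ∑ z : Fin m → M, (∏ c, r (y c)) * (∏ c, r (z c)) * F y z := by
  rw [← Fintype.sum_prod_type' (f := fun y z : Fin m → M =>
    (∏ c, r (y c)) * (∏ c, r (z c)) * F y z)]
  refine Fintype.sum_equiv (Equiv.sumArrowEquivProdArrow _ _ _) _ _ fun x => ?_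
  rw [Fintype.prod_sum_type]
  rfl

/-- The two groups are independent, so the expectation of each summand factorises. Counting only
collisions across the groups leaves no diagonal term, hence no bias. -/
theorem sum_prod_mul_collisionStat [DecidableEq M] {m : ℕ} (r : M → ℝ) (hr : ∑ s, r s = 1) :
    ∑ x : Fin m ⊕ Fin m → M, (∏ c, r (x c)) * collisionStat x
      = (m : ℝ) ^ 2 * sqDistUniform r := by
  have h := sum_prod_sumType (m := m) r fun y z =>
    ∑ s, (∑ i, centredIndicator s (y i)) * ∑ i, centredIndicator s (z i)
  refine h.trans ?_
  calc _ = ∑ s, (∑ y : Fin m → M, (∏ c, r (y c)) * ∑ i, centredIndicator s (y i))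
        * ∑ z : Fin m → M, (∏ c, r (z c)) * ∑ i, centredIndicator s (z i) := by
        have h1 : ∀ y z : Fin m → M, (∏ c, r (y c)) * (∏ c, r (z c)) *
            (∑ s, (∑ i, centredIndicator s (y i)) * ∑ i, centredIndicator s (z i))
            = ∑ s, ((∏ c, r (y c)) * ∑ i, centredIndicator s (y i))
              * ((∏ c, r (z c)) * ∑ i, centredIndicator s (z i)) := by
          intro y z
          rw [Finset.mul_sum]
          refine Finset.sum_congr rfl fun s _ => ?_
          ring
        rw [Finset.sum_congr rfl fun y _ => Finset.sum_congr rfl fun z _ => h1 y z]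
        simp_rw [Finset.sum_comm (s := (Finset.univ : Finset (Fin m → M)))
          (t := (Finset.univ : Finset M))]
        refine Finset.sum_congr rfl fun s _ => ?_
        rw [← Finset.sum_mul_sum]
    _ = _ := by
        simp_rw [sum_prod_mul_sum r hr, sum_mul_centredIndicator r hr]
        rw [sqDistUniform, Finset.mul_sum]
        refine Finset.sum_congr rfl fun s _ => ?_
        rw [Fintype.card_fin]
        ring

/-- Expanding the square over pairs `s`, `t`, both groups contribute the same mixed second moment,
which therefore appears squared. -/
theorem sum_prod_mul_collisionStat_sq [DecidableEq M] {m : ℕ} (r : M → ℝ) (hr : ∑ s, r s = 1) :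
    ∑ x : Fin m ⊕ Fin m → M, (∏ c, r (x c)) * collisionStat x ^ 2
      = ∑ s, ∑ t, ((m : ℝ) ^ 2 * ((r s - (Fintype.card M : ℝ)⁻¹) * (r t - (Fintype.card M : ℝ)⁻¹))
          + m * ((if s = t then r s else 0) - r s * r t)) ^ 2 := by
  have h := sum_prod_sumType (m := m) r fun y z =>
    (∑ s, (∑ i, centredIndicator s (y i)) * ∑ i, centredIndicator s (z i)) ^ 2
  refine h.trans ?_
  calc _ = ∑ s, ∑ t, (∑ y : Fin m → M, (∏ c, r (y c)) *
          ((∑ i, centredIndicator s (y i)) * ∑ i, centredIndicator t (y i)))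
        * ∑ z : Fin m → M, (∏ c, r (z c)) *
          ((∑ i, centredIndicator s (z i)) * ∑ i, centredIndicator t (z i)) := by
        have h1 : ∀ y z : Fin m → M, (∏ c, r (y c)) * (∏ c, r (z c)) *
            (∑ s, (∑ i, centredIndicator s (y i)) * ∑ i, centredIndicator s (z i)) ^ 2
            = ∑ s, ∑ t, ((∏ c, r (y c)) *
                ((∑ i, centredIndicator s (y i)) * ∑ i, centredIndicator t (y i)))
              * ((∏ c, r (z c)) *
                ((∑ i, centredIndicator s (z i)) * ∑ i, centredIndicator t (z i))) := by
          intro y z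
          rw [sq, Finset.sum_mul_sum, Finset.mul_sum]
          refine Finset.sum_congr rfl fun s _ => ?_
          rw [Finset.mul_sum]
          refine Finset.sum_congr rfl fun t _ => ?_
          ring
        rw [Finset.sum_congr rfl fun y _ => Finset.sum_congr rfl fun z _ => h1 y z]
        simp_rw [Finset.sum_comm (s := (Finset.univ : Finset (Fin m → M)))
          (t := (Finset.univ : Finset M))]
        refine Finset.sum_congr rfl fun s _ => Finset.sum_congr rfl fun t _ => ?_
        rw [← Finset.sum_mul_sum]
    _ = _ := by
        refine Finset.sum_congr rfl fun s _ => Finset.sum_congr rfl fun t _ => ?_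
        rw [sum_prod_mul_sum_mul_sum r hr, sum_mul_centredIndicator r hr,
          sum_mul_centredIndicator r hr, sum_mul_centredIndicator_mul r hr, Fintype.card_fin]
        ring

theorem sum_sq_eq_sqDistUniform [Nonempty M] (r : M → ℝ) (hr : ∑ s, r s = 1) :
    ∑ s, r s ^ 2 = (Fintype.card M : ℝ)⁻¹ + sqDistUniform r := by
  have hL : (Fintype.card M : ℝ) ≠ 0 := by simp
  have h : ∀ s, (r s - (Fintype.card M : ℝ)⁻¹) ^ 2
      = r s ^ 2 - 2 * (Fintype.card M : ℝ)⁻¹ * r s + (Fintype.card M : ℝ)⁻¹ ^ 2 := fun s => by ring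
  rw [sqDistUniform, Finset.sum_congr rfl fun s _ => h s, Finset.sum_add_distrib,
    Finset.sum_sub_distrib, ← Finset.mul_sum, hr]
  simp
  field_simp
  ring

/-- The left side equals `∑ r² - 2 ∑ r³ + (∑ r²)²`, and Cauchy–Schwarz with `∑ r = 1` gives `(∑ r²)²
≤ ∑ r³`. -/
theorem sum_sum_covariance_sq_le [DecidableEq M] (r : M → ℝ) (hr : ∑ s, r s = 1) (h0 : ∀ s, 0 ≤ r s) :
    ∑ s, ∑ t, ((if s = t then r s else 0) - r s * r t) ^ 2 ≤ ∑ s, r s ^ 2 := by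
  have h1 : ∀ s t, ((if s = t then r s else 0) - r s * r t) ^ 2
      = (if s = t then r s ^ 2 - 2 * r s ^ 3 else 0) + r s ^ 2 * r t ^ 2 := by
    intro s t
    by_cases h : s = t
    · subst h; simp; ring
    · simp [h]; ring
  simp_rw [h1, Finset.sum_add_distrib, ← Finset.mul_sum, ← Finset.sum_mul]
  simp only [Finset.sum_ite_eq, Finset.mem_univ, if_true, Finset.sum_sub_distrib]
  have hcs : (∑ s, r s ^ 2) ^ 2 ≤ (∑ s, r s) * ∑ s, r s ^ 3 :=
    Finset.sum_sq_le_sum_mul_sum_of_sq_le_mul _ (fun s _ => h0 s) (fun s _ => pow_nonneg (h0 s) 3)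
      fun s _ => le_of_eq (by ring)
  have h3 : 0 ≤ ∑ s, r s ^ 3 := Finset.sum_nonneg fun s _ => pow_nonneg (h0 s) 3
  rw [hr] at hcs
  rw [← Finset.mul_sum]
  nlinarith

/-- The covariance form at the deviation vector is `∑ (r - c)² r` minus a square, and every `r s` is
at most `c + √D`, because one squared deviation cannot exceed their sum `D`. -/
theorem sum_sum_mul_covariance_le [DecidableEq M] (r : M → ℝ) :
    ∑ s, ∑ t, ((r s - (Fintype.card M : ℝ)⁻¹) * (r t - (Fintype.card M : ℝ)⁻¹))
        * ((if s = t then r s else 0) - r s * r t)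
      ≤ sqDistUniform r * (Fintype.card M : ℝ)⁻¹ + sqDistUniform r * √(sqDistUniform r) := by
  set c := (Fintype.card M : ℝ)⁻¹ with hc
  have h1 : ∀ s t, ((r s - c) * (r t - c)) * ((if s = t then r s else 0) - r s * r t)
      = (if s = t then (r s - c) ^ 2 * r s else 0) - ((r s - c) * r s) * ((r t - c) * r t) := by
    intro s t
    by_cases h : s = t
    · subst h; simp; ring
    · simp [h]; ring
  simp_rw [h1, Finset.sum_sub_distrib, ← Finset.mul_sum, ← Finset.sum_mul]
  simp only [Finset.sum_ite_eq, Finset.mem_univ, if_true]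
  have h2 : ∑ s, (r s - c) ^ 2 * r s
      ≤ ∑ s, (r s - c) ^ 2 * (c + √(sqDistUniform r)) := by
    refine Finset.sum_le_sum fun s _ => mul_le_mul_of_nonneg_left ?_ (sq_nonneg _)
    have : r s - c ≤ √(sqDistUniform r) := by
      refine Real.le_sqrt_of_sq_le ?_
      exact Finset.single_le_sum (f := fun s => (r s - c) ^ 2) (fun _ _ => sq_nonneg _)
        (Finset.mem_univ s)
    linarith
  rw [← Finset.sum_mul] at h2
  have h3 : ∑ s, (r s - c) ^ 2 = sqDistUniform r := rfl
  rw [h3] at h2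
  nlinarith [mul_self_nonneg (∑ s, (r s - c) * r s)]

/-- The variance of the collision statistic. -/
theorem variance_collisionStat_le [DecidableEq M] [Nonempty M] {m : ℕ} (r : M → ℝ) (hr : ∑ s, r s = 1)
    (h0 : ∀ s, 0 ≤ r s) :
    ∑ x : Fin m ⊕ Fin m → M, (∏ c, r (x c))
        * (collisionStat x - (m : ℝ) ^ 2 * sqDistUniform r) ^ 2
      ≤ 2 * (m : ℝ) ^ 3 * (sqDistUniform r * (Fintype.card M : ℝ)⁻¹
          + sqDistUniform r * √(sqDistUniform r))
        + (m : ℝ) ^ 2 * ((Fintype.card M : ℝ)⁻¹ + sqDistUniform r) := by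
  have e1 := sum_prod_mul_collisionStat (m := m) r hr
  have e2 := sum_prod_mul_collisionStat_sq (m := m) r hr
  have e0 : ∑ x : Fin m ⊕ Fin m → M, ∏ c, r (x c) = 1 := by
    rw [sum_pi_prod fun _ a => r a]; simp [hr]
  have b1 := sum_sum_covariance_sq_le r hr h0
  rw [sum_sq_eq_sqDistUniform r hr] at b1
  have b2 := sum_sum_mul_covariance_le r
  set c := (Fintype.card M : ℝ)⁻¹ with hc
  set D := sqDistUniform r with hD
  have h1 : ∀ x : Fin m ⊕ Fin m → M, (∏ c, r (x c)) * (collisionStat x - (m : ℝ) ^ 2 * D) ^ 2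
      = (∏ c, r (x c)) * collisionStat x ^ 2
        - 2 * ((m : ℝ) ^ 2 * D) * ((∏ c, r (x c)) * collisionStat x)
        + ((m : ℝ) ^ 2 * D) ^ 2 * ∏ c, r (x c) := fun x => by ring
  have h2 : ∀ s t, ((m : ℝ) ^ 2 * ((r s - c) * (r t - c))
        + m * ((if s = t then r s else 0) - r s * r t)) ^ 2
      = (m : ℝ) ^ 4 * ((r s - c) ^ 2 * (r t - c) ^ 2)
        + 2 * (m : ℝ) ^ 3 * (((r s - c) * (r t - c)) * ((if s = t then r s else 0) - r s * r t))
        + (m : ℝ) ^ 2 * ((if s = t then r s else 0) - r s * r t) ^ 2 := fun s t => by ring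
  simp_rw [h2, Finset.sum_add_distrib, ← Finset.mul_sum] at e2
  -- The term of order `m⁴` in the second moment is exactly the squared mean, so it cancels in the
  -- variance.
  have h4 : ∑ s, (r s - c) ^ 2 * ∑ t, (r t - c) ^ 2 = D * D := by
    rw [← Finset.sum_mul]; rfl
  rw [h4] at e2
  rw [Finset.sum_congr rfl fun x _ => h1 x, Finset.sum_add_distrib, Finset.sum_sub_distrib,
    ← Finset.mul_sum, ← Finset.mul_sum, e0, e1, e2]
  have b3 := mul_le_mul_of_nonneg_left b1 (sq_nonneg (m : ℝ))
  have b4 := mul_le_mul_of_nonneg_left b2 (by positivity : (0 : ℝ) ≤ 2 * (m : ℝ) ^ 3)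
  linarith

end CollisionStatistic

/-- Chebyshev's inequality for finite sums. -/
theorem sum_indicator_mul_sq_le {X : Type*} [Fintype X] (w f : X → ℝ) (hw : ∀ x, 0 ≤ w x)
    (μ a : ℝ) (p : X → Prop) [DecidablePred p] (hp : ∀ x, p x → a ^ 2 ≤ (f x - μ) ^ 2) :
    (∑ x, if p x then w x else 0) * a ^ 2 ≤ ∑ x, w x * (f x - μ) ^ 2 := by
  rw [Finset.sum_mul]
  refine Finset.sum_le_sum fun x _ => ?_
  split_ifs with h
  · exact mul_le_mul_of_nonneg_left (hp x h) (hw x)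
  · rw [zero_mul]
    exact mul_nonneg (hw x) (sq_nonneg _)

/-! ### Error probabilities within one block -/

section BlockTest

variable {M : Type*} [Fintype M] [DecidableEq M] [Nonempty M]

/-- Under uniformity the mean is `0` and the variance at most `m²/L`, so Chebyshev gives at most
`4/(m g √L)² ≤ 4/10⁶`. -/
theorem collisionStat_false_alarm {m : ℕ} {g : ℝ} (hg : 0 < g)
    (hm : 1000 ≤ m * g * √(Fintype.card M)) (r : M → ℝ) (hr : ∑ s, r s = 1) (h0 : ∀ s, 0 ≤ r s)
    (hD : sqDistUniform r = 0) :
    (∑ x : Fin m ⊕ Fin m → M,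
      if (m : ℝ) ^ 2 * g / 2 < collisionStat x then ∏ c, r (x c) else 0) ≤ 1 / 2000 := by
  have hv := variance_collisionStat_le (m := m) r hr h0
  rw [hD] at hv
  have hch := sum_indicator_mul_sq_le (fun x : Fin m ⊕ Fin m → M => ∏ c, r (x c)) collisionStat
    (fun x => Finset.prod_nonneg fun c _ => h0 _) ((m : ℝ) ^ 2 * 0) ((m : ℝ) ^ 2 * g / 2)
    (fun x => (m : ℝ) ^ 2 * g / 2 < collisionStat x) fun x hx => by
      have : 0 ≤ (m : ℝ) ^ 2 * g / 2 := by positivity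
      rw [mul_zero, sub_zero]
      exact pow_le_pow_left₀ this hx.le 2
  have hL : (0 : ℝ) < Fintype.card M := by exact_mod_cast Fintype.card_pos
  have hs := Real.sq_sqrt hL.le
  have hsp := Real.sqrt_pos.2 hL
  have hmp : (0 : ℝ) < m := by
    by_contra hcon
    have : (m : ℝ) = 0 := le_antisymm (not_lt.1 hcon) (Nat.cast_nonneg m)
    rw [this] at hm
    norm_num at hm
  set P := ∑ x : Fin m ⊕ Fin m → M,
      if (m : ℝ) ^ 2 * g / 2 < collisionStat x then ∏ c, r (x c) else 0 with hP
  have h1 : P * ((m : ℝ) ^ 2 * g / 2) ^ 2 ≤ (m : ℝ) ^ 2 * (Fintype.card M : ℝ)⁻¹ := by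
    refine (hch.trans hv).trans (le_of_eq ?_)
    ring
  have h2 : 1000 ^ 2 ≤ (m : ℝ) ^ 2 * g ^ 2 * Fintype.card M := by
    have := pow_le_pow_left₀ (by norm_num) hm 2
    rwa [mul_pow, mul_pow, hs] at this
  have h3 : (m : ℝ) ^ 2 * (Fintype.card M : ℝ)⁻¹ * 1000 ^ 2 ≤ (m : ℝ) ^ 4 * g ^ 2 := by
    have := mul_le_mul_of_nonneg_left h2
      (by positivity : 0 ≤ (m : ℝ) ^ 2 * (Fintype.card M : ℝ)⁻¹)
    refine this.trans (le_of_eq ?_)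
    field_simp
  have h4 : 0 < (m : ℝ) ^ 4 * g ^ 2 := by positivity
  have h5 : P * ((m : ℝ) ^ 4 * g ^ 2) ≤ 1 / 2000 * ((m : ℝ) ^ 4 * g ^ 2) := by nlinarith
  exact le_of_mul_le_mul_right h5 h4

/-- The threshold is at most half the mean `m² D`. Relative to `m⁴ D²`, each of the four variance
terms is small because both `m D √L` and `m √D` are at least `1000`. -/
theorem collisionStat_missed_detection {m : ℕ} {g : ℝ} (hg : 0 < g)
    (hm : 1000 ≤ m * g * √(Fintype.card M)) (hgL : g * Fintype.card M ≤ 1)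
    (r : M → ℝ) (hr : ∑ s, r s = 1) (h0 : ∀ s, 0 ≤ r s) (hD : g ≤ sqDistUniform r) :
    (∑ x : Fin m ⊕ Fin m → M,
      if collisionStat x ≤ (m : ℝ) ^ 2 * g / 2 then ∏ c, r (x c) else 0) ≤ 1 / 40 := by
  have hv := variance_collisionStat_le (m := m) r hr h0
  set D := sqDistUniform r with hDdef
  have hDp : 0 < D := hg.trans_le hD
  have hch := sum_indicator_mul_sq_le (fun x : Fin m ⊕ Fin m → M => ∏ c, r (x c)) collisionStat
    (fun x => Finset.prod_nonneg fun c _ => h0 _) ((m : ℝ) ^ 2 * D) ((m : ℝ) ^ 2 * D / 2)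
    (fun x => collisionStat x ≤ (m : ℝ) ^ 2 * g / 2) fun x hx => by
      have h1 : (m : ℝ) ^ 2 * g ≤ (m : ℝ) ^ 2 * D := mul_le_mul_of_nonneg_left hD (sq_nonneg _)
      have h2 : 0 ≤ (m : ℝ) ^ 2 * D := by positivity
      nlinarith
  have hL : (1 : ℝ) ≤ Fintype.card M := by exact_mod_cast Fintype.card_pos
  have hs := Real.sq_sqrt (zero_le_one.trans hL)
  have hs1 : 1 ≤ √(Fintype.card M : ℝ) := Real.one_le_sqrt.2 hL
  have hmp : (0 : ℝ) < m := by
    by_contra hcon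
    have : (m : ℝ) = 0 := le_antisymm (not_lt.1 hcon) (Nat.cast_nonneg m)
    rw [this] at hm
    norm_num at hm
  set P := ∑ x : Fin m ⊕ Fin m → M,
      if collisionStat x ≤ (m : ℝ) ^ 2 * g / 2 then ∏ c, r (x c) else 0 with hP
  set L := (Fintype.card M : ℝ) with hLdef
  have hLp : 0 < L := by linarith
  have hDs := Real.sq_sqrt hDp.le
  have hDsp := Real.sqrt_pos.2 hDp
  have k1 : 1000 ≤ m * D * √L :=
    hm.trans (mul_le_mul_of_nonneg_right (mul_le_mul_of_nonneg_left hD hmp.le) (by positivity))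
  -- Since `g L ≤ 1`, the quantity `m g √L = m √g · √(g L)` is at most `m √g`.
  have k2 : 1000 ≤ m * √D := by
    have h1 : √g * √L ≤ 1 := by
      rw [← Real.sqrt_mul hg.le]
      exact Real.sqrt_le_one.2 hgL
    have h2 : m * g * √L = m * √g * (√g * √L) := by
      nth_rewrite 1 [← Real.mul_self_sqrt hg.le]
      ring
    have h3 : m * √g * (√g * √L) ≤ m * √g * 1 := mul_le_mul_of_nonneg_left h1 (by positivity)
    have h4 : m * √g ≤ m * √D := mul_le_mul_of_nonneg_left (Real.sqrt_le_sqrt hD) hmp.le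
    linarith
  have a1 : D * L⁻¹ * 1000 ≤ m * D ^ 2 := by
    have h1 : 1000 ≤ m * D * L := by
      refine k1.trans (mul_le_mul_of_nonneg_left ?_ (by positivity))
      nlinarith
    have h2 := mul_le_mul_of_nonneg_left h1 (by positivity : 0 ≤ D * L⁻¹)
    refine h2.trans (le_of_eq ?_)
    field_simp
  have a2 : D * √D * 1000 ≤ m * D ^ 2 := by
    have h2 := mul_le_mul_of_nonneg_left k2 (by positivity : 0 ≤ D * √D)
    refine h2.trans (le_of_eq ?_)
    linear_combination m * D * hDs
  have a3 : L⁻¹ * 1000 ^ 2 ≤ (m : ℝ) ^ 2 * D ^ 2 := by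
    have h1 := pow_le_pow_left₀ (by norm_num) k1 2
    rw [mul_pow, mul_pow, hs] at h1
    have h2 := mul_le_mul_of_nonneg_left h1 (by positivity : 0 ≤ L⁻¹)
    refine h2.trans (le_of_eq ?_)
    field_simp
  have a4 : D * 1000 ^ 2 ≤ (m : ℝ) ^ 2 * D ^ 2 := by
    have h1 := pow_le_pow_left₀ (by norm_num) k2 2
    rw [mul_pow, hDs] at h1
    have h2 := mul_le_mul_of_nonneg_left h1 hDp.le
    refine h2.trans (le_of_eq ?_)
    ring
  have h4 : 0 < (m : ℝ) ^ 4 * D ^ 2 := by positivity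
  have b1 := mul_le_mul_of_nonneg_left a1 (by positivity : 0 ≤ (m : ℝ) ^ 3)
  have b2 := mul_le_mul_of_nonneg_left a2 (by positivity : 0 ≤ (m : ℝ) ^ 3)
  have b3 := mul_le_mul_of_nonneg_left a3 (by positivity : 0 ≤ (m : ℝ) ^ 2)
  have b4 := mul_le_mul_of_nonneg_left a4 (by positivity : 0 ≤ (m : ℝ) ^ 2)
  have h5 : P * ((m : ℝ) ^ 4 * D ^ 2) ≤ 1 / 40 * ((m : ℝ) ^ 4 * D ^ 2) := by
    have := hch.trans hv
    ring_nf at this b1 b2 b3 b4 ⊢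
    linarith
  exact le_of_mul_le_mul_right h5 h4

end BlockTest

/-! ### Anticoncentration of random signed sums -/

section RandomSigns

variable {E : Type*} [NormedAddCommGroup E]

theorem sum_bool_cons {h : ℕ} (f : (Fin (h + 1) → Bool) → ℝ) :
    ∑ ξ, f ξ = ∑ ξ : Fin h → Bool, (f (Fin.cons true ξ) + f (Fin.cons false ξ)) := by
  rw [← (Fin.consEquiv fun _ => Bool).sum_comp, Fintype.sum_prod_type_right]
  refine Finset.sum_congr rfl fun ξ _ => ?_
  rw [Fintype.sum_bool]
  rfl

/-- A random signed sum. -/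
def signedSum {h : ℕ} (v : E) (w : Fin h → E) (ξ : Fin h → Bool) : E :=
  v + ∑ p, if ξ p then w p else -w p

theorem signedSum_cons {h : ℕ} (v : E) (w : Fin (h + 1) → E) (b : Bool) (ξ : Fin h → Bool) :
    signedSum v w (Fin.cons b ξ)
      = signedSum v (fun p => w p.succ) ξ + if b then w 0 else -w 0 := by
  simp only [signedSum, Fin.sum_univ_succ, Fin.cons_zero, Fin.cons_succ]
  abel

theorem sum_norm_signedSum_sq [InnerProductSpace ℝ E] {h : ℕ} (v : E) (w : Fin h → E) :
    ∑ ξ, ‖signedSum v w ξ‖ ^ 2 = 2 ^ h * (‖v‖ ^ 2 + ∑ p, ‖w p‖ ^ 2) := by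
  induction h with
  | zero => simp [signedSum]
  | succ h ih =>
    have h1 : ∀ ξ : Fin h → Bool, ‖signedSum v w (Fin.cons true ξ)‖ ^ 2
        + ‖signedSum v w (Fin.cons false ξ)‖ ^ 2
        = 2 * ‖signedSum v (fun p => w p.succ) ξ‖ ^ 2 + 2 * ‖w 0‖ ^ 2 := by
      intro ξ
      rw [signedSum_cons, signedSum_cons]
      have := parallelogram_law_with_norm ℝ (signedSum v (fun p => w p.succ) ξ) (w 0)
      simp only [if_true, Bool.false_eq_true, if_false, ← sub_eq_add_neg]
      nlinarith
    rw [sum_bool_cons, Finset.sum_congr rfl fun ξ _ => h1 ξ, Finset.sum_add_distrib,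
      ← Finset.mul_sum, ih, Fin.sum_univ_succ]
    simp
    ring

/-- Averaging over one sign leaves `2 (‖a‖² + ‖w‖²)² + 8 ⟨a, w⟩²`, and Cauchy–Schwarz bounds the
cross term. The resulting coefficient `12` of `‖a‖² ‖w‖²` is what the constant `3` absorbs in the
induction. -/
theorem sum_norm_signedSum_pow_four_le [InnerProductSpace ℝ E] {h : ℕ} (v : E) (w : Fin h → E) :
    ∑ ξ, ‖signedSum v w ξ‖ ^ 4 ≤ 3 * 2 ^ h * (‖v‖ ^ 2 + ∑ p, ‖w p‖ ^ 2) ^ 2 := by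
  induction h with
  | zero =>
    simp [signedSum]
    nlinarith [sq_nonneg (‖v‖ ^ 2)]
  | succ h ih =>
    have h1 : ∀ ξ : Fin h → Bool, ‖signedSum v w (Fin.cons true ξ)‖ ^ 4
        + ‖signedSum v w (Fin.cons false ξ)‖ ^ 4
        ≤ 2 * ‖signedSum v (fun p => w p.succ) ξ‖ ^ 4
          + 12 * ‖w 0‖ ^ 2 * ‖signedSum v (fun p => w p.succ) ξ‖ ^ 2 + 2 * ‖w 0‖ ^ 4 := by
      intro ξ
      rw [signedSum_cons, signedSum_cons]
      set a := signedSum v (fun p => w p.succ) ξ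
      have e1 := norm_add_sq_real a (w 0)
      have e2 := norm_sub_sq_real a (w 0)
      have e3 : inner ℝ a (w 0) ^ 2 ≤ ‖a‖ ^ 2 * ‖w 0‖ ^ 2 := by
        rw [← mul_pow, ← sq_abs]
        exact pow_le_pow_left₀ (abs_nonneg _) (abs_real_inner_le_norm _ _) 2
      simp only [if_true, Bool.false_eq_true, if_false, ← sub_eq_add_neg]
      have e4 : ∀ t : ℝ, t ^ 4 = (t ^ 2) ^ 2 := fun t => by ring
      rw [e4, e4, e4, e4, e1, e2]
      nlinarith
    have ih2 := sum_norm_signedSum_sq v fun p : Fin h => w p.succ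
    have ih4 := ih fun p => w p.succ
    rw [sum_bool_cons]
    refine (Finset.sum_le_sum fun ξ _ => h1 ξ).trans ?_
    rw [Finset.sum_add_distrib, Finset.sum_add_distrib, ← Finset.mul_sum, ← Finset.mul_sum, ih2,
      Fin.sum_univ_succ]
    simp only [Finset.sum_const, Finset.card_univ, Fintype.card_pi, Fintype.card_bool,
      Finset.prod_const, Fintype.card_fin, nsmul_eq_mul]
    push_cast
    set B := ‖v‖ ^ 2 + ∑ p : Fin h, ‖w p.succ‖ ^ 2
    have e5 : ‖v‖ ^ 2 + (‖w 0‖ ^ 2 + ∑ p : Fin h, ‖w p.succ‖ ^ 2) = B + ‖w 0‖ ^ 2 := by ring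
    rw [e5, pow_succ (2 : ℝ) h]
    have e6 : 0 ≤ (2 : ℝ) ^ h * ‖w 0‖ ^ 4 := by positivity
    nlinarith

/-- A random signed sum is not much shorter than expected with constant probability. -/
theorem card_half_le_norm_signedSum_sq [InnerProductSpace ℝ E] {h : ℕ} (v : E) (w : Fin h → E) {T : ℝ}
    (hT : T ≤ ‖v‖ ^ 2 + ∑ p, ‖w p‖ ^ 2) :
    (2 : ℝ) ^ h / 10 ≤ ∑ ξ, if T / 2 ≤ ‖signedSum v w ξ‖ ^ 2 then (1 : ℝ) else 0 := by
  set B := ‖v‖ ^ 2 + ∑ p, ‖w p‖ ^ 2 with hB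
  have hB0 : 0 ≤ B := by positivity
  have h2 := sum_norm_signedSum_sq v w
  have h4 := sum_norm_signedSum_pow_four_le v w
  rw [← hB] at h2 h4
  rcases hB0.eq_or_lt with hB0 | hB0
  · have h3 : ∀ ξ, T / 2 ≤ ‖signedSum v w ξ‖ ^ 2 := fun ξ =>
      le_trans (by linarith) (sq_nonneg _)
    simp [h3]
    linarith [pow_pos (zero_lt_two (α := ℝ)) h]
  -- A quadratic in `Z = ‖signedSum v w ξ‖²` with roots `B/2` and `21B/2` and maximum `25 B²`, so it
  -- lies below `25 B²` times the indicator. Its mean is at least `(11 - 3 - 21/4) B² = 11/4 B²`,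
  -- and `11/100 ≥ 1/10`.
  have h1 : ∀ ξ, -‖signedSum v w ξ‖ ^ 4 + 11 * B * ‖signedSum v w ξ‖ ^ 2 - 21 / 4 * B ^ 2
      ≤ 25 * B ^ 2 * if T / 2 ≤ ‖signedSum v w ξ‖ ^ 2 then (1 : ℝ) else 0 := by
    intro ξ
    split_ifs with hc
    · nlinarith [sq_nonneg (‖signedSum v w ξ‖ ^ 2 - 11 / 2 * B)]
    · nlinarith
  have h5 := Finset.sum_le_sum fun ξ (_ : ξ ∈ Finset.univ) => h1 ξ
  rw [← Finset.mul_sum, Finset.sum_sub_distrib, Finset.sum_add_distrib, ← Finset.mul_sum, h2,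
    Finset.sum_neg_distrib] at h5
  simp only [Finset.sum_const, Finset.card_univ, Fintype.card_pi, Fintype.card_bool,
      Finset.prod_const, Fintype.card_fin, nsmul_eq_mul] at h5
  push_cast at h5
  have h6 : (25 * B ^ 2) * ((2 : ℝ) ^ h / 10)
      ≤ (25 * B ^ 2) * ∑ ξ, if T / 2 ≤ ‖signedSum v w ξ‖ ^ 2 then (1 : ℝ) else 0 := by
    have : 0 ≤ (2 : ℝ) ^ h * B ^ 2 := by positivity
    nlinarith
  exact le_of_mul_le_mul_left h6 (by positivity)

end RandomSigns

/-! ### Random swaps and rotations of paired masses -/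

section Pairing

variable {M : Type*} [Fintype M] [DecidableEq M]

/-- The masses of the parts when the two masses `x p` and `y p` are put, in an order determined by
the coin `ξ p`, into the parts `g true p` and `g false p`. -/
def pairedMass {h : ℕ} (g : Bool → Fin h → M) (x y : Fin h → ℝ) (ξ : Fin h → Bool) (s : M) : ℝ :=
  ∑ p, ((if g (ξ p) p = s then x p else 0) + if g (!ξ p) p = s then y p else 0)

/-- Swapping `x p` and `y p` flips the sign of half their difference along `e (g true p) - e (g
false p)`. Distinct labels make this vector of squared length `2`, so the mass vector is a signed
sum with energy at least `∑ (x p - y p)² / 2`. -/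
theorem card_le_sum_pairedMass_sq {h : ℕ} {g : Bool → Fin h → M} (hg : ∀ p, g true p ≠ g false p)
    (x y : Fin h → ℝ) :
    (2 : ℝ) ^ h / 10 ≤ ∑ ξ, if (∑ p, (x p - y p) ^ 2 / 2) / 2 ≤ ∑ s, pairedMass g x y ξ s ^ 2
      then (1 : ℝ) else 0 := by
  let e : M → EuclideanSpace ℝ M := fun s => EuclideanSpace.single s 1
  let v : EuclideanSpace ℝ M :=
    ∑ p, ((x p + y p) / 2) • (e (g true p) + e (g false p))
  let w : Fin h → EuclideanSpace ℝ M := fun p =>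
    ((x p - y p) / 2) • (e (g true p) - e (g false p))
  have hw : ∀ p, ‖w p‖ ^ 2 = (x p - y p) ^ 2 / 2 := by
    intro p
    have h1 : ‖e (g true p) - e (g false p)‖ ^ 2 = 2 := by
      rw [norm_sub_sq_real]
      simp [e, EuclideanSpace.inner_single_left, hg p]
      norm_num
    rw [norm_smul, mul_pow, h1, Real.norm_eq_abs, sq_abs]
    ring
  have hV : ∀ ξ, ‖signedSum v w ξ‖ ^ 2 = ∑ s, pairedMass g x y ξ s ^ 2 := by
    intro ξ
    have h1 : signedSum v w ξ = ∑ p, (x p • e (g (ξ p) p) + y p • e (g (!ξ p) p)) := by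
      rw [signedSum, ← Finset.sum_add_distrib]
      refine Finset.sum_congr rfl fun p _ => ?_
      cases ξ p
      · simp only [Bool.false_eq_true, if_false, Bool.not_false, w]
        module
      · simp only [if_true, Bool.not_true, w]
        module
    rw [h1, EuclideanSpace.real_norm_sq_eq]
    refine Finset.sum_congr rfl fun s _ => ?_
    congr 1
    simp [pairedMass, e, Pi.single_apply, eq_comm]
  have h1 := card_half_le_norm_signedSum_sq v w (T := ∑ p, (x p - y p) ^ 2 / 2) (by
    rw [Finset.sum_congr rfl fun p _ => hw p]
    linarith [sq_nonneg ‖v‖])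
  simpa only [hV] using h1

/-- Over all rotations each `x p` meets each `y q` once, so the cross terms add up to `-(∑ x)(∑ y)`,
which equals `(∑ x)² ≥ 0` as the total mass vanishes. -/
theorem sum_rotation_sq {h : ℕ} [NeZero h] (x y : Fin h → ℝ)
    (hxy : ∑ p, x p + ∑ p, y p = 0) :
    (h : ℝ) * ((∑ p, x p ^ 2 + ∑ p, y p ^ 2) / 2) ≤ ∑ r, ∑ p, (x p - y (p + r)) ^ 2 / 2 := by
  have h1 : ∀ p, ∑ r, (x p - y (p + r)) ^ 2 / 2
      = h * (x p ^ 2 / 2) - x p * (∑ q, y q) + (∑ q, y q ^ 2) / 2 := by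
    intro p
    have h2 := Equiv.sum_comp (Equiv.addLeft p) fun q => (x p - y q) ^ 2 / 2
    simp only [Equiv.coe_addLeft] at h2
    rw [h2]
    have h3 : ∀ q, (x p - y q) ^ 2 / 2 = x p ^ 2 / 2 - x p * y q + y q ^ 2 / 2 := fun q => by ring
    rw [Finset.sum_congr rfl fun q _ => h3 q, Finset.sum_add_distrib, Finset.sum_sub_distrib,
      ← Finset.mul_sum, Finset.sum_div]
    simp only [Finset.sum_const, Finset.card_univ, Fintype.card_fin, nsmul_eq_mul]
  rw [Finset.sum_comm, Finset.sum_congr rfl fun p _ => h1 p, Finset.sum_add_distrib,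
    Finset.sum_sub_distrib, ← Finset.mul_sum, ← Finset.sum_mul, ← Finset.sum_div]
  simp only [Finset.sum_const, Finset.card_univ, Fintype.card_fin, nsmul_eq_mul]
  have h2 : ∑ q, y q = -∑ p, x p := by linarith
  rw [h2]
  nlinarith [mul_self_nonneg (∑ p, x p)]

/-- A random rotation of `y` against `x` followed by random swaps preserves a constant fraction of
the energy with constant probability. -/
theorem card_le_sum_rotated_pairedMass_sq {h : ℕ} [NeZero h] {g : Bool → Fin h → M}
    (hg : ∀ p, g true p ≠ g false p) (x y : Fin h → ℝ) (hxy : ∑ p, x p + ∑ p, y p = 0) :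
    (h : ℝ) * 2 ^ h / 30 ≤ ∑ r, ∑ ξ,
      if (∑ p, x p ^ 2 + ∑ p, y p ^ 2) / 8 ≤ ∑ s, pairedMass g x (fun p => y (p + r)) ξ s ^ 2
      then (1 : ℝ) else 0 := by
  set W := ∑ p, x p ^ 2 + ∑ p, y p ^ 2 with hW
  have hW0 : 0 ≤ W := by positivity
  have hrot := sum_rotation_sq x y hxy
  rw [← hW] at hrot
  have hT : ∀ r, ∑ p, (x p - y (p + r)) ^ 2 / 2 ≤ W := by
    intro r
    have h2 := Equiv.sum_comp (Equiv.addRight r) fun q => y q ^ 2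
    simp only [Equiv.coe_addRight] at h2
    rw [hW, ← h2, ← Finset.sum_add_distrib]
    refine Finset.sum_le_sum fun p _ => ?_
    nlinarith [sq_nonneg (x p + y (p + r))]
  have hin : ∀ r, (2 : ℝ) ^ h / 10 *
        (if W / 4 ≤ ∑ p, (x p - y (p + r)) ^ 2 / 2 then (1 : ℝ) else 0)
      ≤ ∑ ξ, if W / 8 ≤ ∑ s, pairedMass g x (fun p => y (p + r)) ξ s ^ 2
        then (1 : ℝ) else 0 := by
    intro r
    split_ifs with hc
    · rw [mul_one]
      refine (card_le_sum_pairedMass_sq hg x fun p => y (p + r)).trans ?_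
      refine Finset.sum_le_sum fun ξ _ => ?_
      split_ifs with c1 c2
      · exact le_rfl
      · exact absurd (le_trans (by linarith) c1) c2
      · exact zero_le_one
      · exact le_rfl
    · rw [mul_zero]
      exact Finset.sum_nonneg fun ξ _ => by split_ifs <;> norm_num
  refine le_trans ?_ (Finset.sum_le_sum fun r _ => hin r)
  rw [← Finset.mul_sum]
  -- The energies are at most `W` and average at least `W/2`, so at least a third of the rotations
  -- have energy at least `W/4`.
  have hcount : (h : ℝ) / 3
      ≤ ∑ r : Fin h, if W / 4 ≤ ∑ p, (x p - y (p + r)) ^ 2 / 2 then (1 : ℝ) else 0 := by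
    rcases hW0.eq_or_lt with hW0 | hW0
    · have : ∀ r : Fin h, W / 4 ≤ ∑ p, (x p - y (p + r)) ^ 2 / 2 := fun r => by
        rw [← hW0, zero_div]
        positivity
      simp [this]
      linarith [(Nat.cast_nonneg h : (0 : ℝ) ≤ h)]
    · have h1 : ∀ r : Fin h, ∑ p, (x p - y (p + r)) ^ 2 / 2
          ≤ W / 4 + 3 * W / 4 *
            if W / 4 ≤ ∑ p, (x p - y (p + r)) ^ 2 / 2 then (1 : ℝ) else 0 := by
        intro r
        split_ifs with hc
        · linarith [hT r]
        · linarith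
      have h2 := hrot.trans (Finset.sum_le_sum fun r _ => h1 r)
      rw [Finset.sum_add_distrib, ← Finset.mul_sum] at h2
      simp only [Finset.sum_const, Finset.card_univ, Fintype.card_fin, nsmul_eq_mul] at h2
      have h3 : 3 * W / 4 * ((h : ℝ) / 3) ≤ 3 * W / 4 *
          ∑ r : Fin h, if W / 4 ≤ ∑ p, (x p - y (p + r)) ^ 2 / 2 then (1 : ℝ) else 0 := by
        linarith
      exact le_of_mul_le_mul_left h3 (by positivity)
  calc (h : ℝ) * 2 ^ h / 30 = 2 ^ h / 10 * (h / 3) := by ring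
    _ ≤ _ := mul_le_mul_of_nonneg_left hcount (by positivity)

end Pairing

/-! ### Random balanced partitions preserve the L2 norm -/

section RandomPartition

variable {K ℓ : ℕ}

/-- The mass given by the weights `d` to the part labelled `s`. -/
def partMass (S : BalancedPartition K ℓ) (d : Fin K → ℝ) (s : Message ℓ) : ℝ :=
  ∑ j, if S.1 j = s then d j else 0

/-- The relabelling of a balanced partition by a permutation. -/
def BalancedPartition.permute (σ : Equiv.Perm (Fin K)) (S : BalancedPartition K ℓ) :
    BalancedPartition K ℓ :=
  ⟨fun j => S.1 (σ j), fun s => by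
    refine Eq.trans ?_ (S.2 s)
    congr 1
    exact Finset.card_equiv σ (by simp)⟩

/-- Permutations act on balanced partitions by bijections. -/
def BalancedPartition.permuteEquiv (σ : Equiv.Perm (Fin K)) :
    BalancedPartition K ℓ ≃ BalancedPartition K ℓ where
  toFun := BalancedPartition.permute σ
  invFun := BalancedPartition.permute σ⁻¹
  left_inv S := by ext j; simp [BalancedPartition.permute]
  right_inv S := by ext j; simp [BalancedPartition.permute]

/-- The elements can be matched in such a way that matched elements lie in different parts. -/
theorem exists_pairing (hℓ : 1 ≤ ℓ) (S : BalancedPartition K ℓ) :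
    ∃ (h : ℕ) (e : Bool × Fin h ≃ Fin K), ∀ p, S.1 (e (true, p)) ≠ S.1 (e (false, p)) := by
  -- Labels with first bit `true` and `false` are equally many, and so are the elements carrying
  -- them, by balance. Any bijection between the two halves pairs elements of different parts.
  let i0 : Fin ℓ := ⟨0, hℓ⟩
  have hcard : ∀ b : Bool, 2 ^ ℓ * Fintype.card {j // S.1 j i0 = b}
      = Fintype.card {s : Message ℓ // s i0 = b} * K := by
    intro b
    rw [Fintype.card_subtype, Fintype.card_subtype,
      Finset.card_eq_sum_card_fiberwise (f := S.1)
        (t := Finset.univ.filter fun s : Message ℓ => s i0 = b) (by intro j; simp),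
      Finset.mul_sum, ← smul_eq_mul, ← Finset.sum_const]
    refine Finset.sum_congr rfl fun s hs => ?_
    refine Eq.trans ?_ (S.2 s)
    rw [Finset.filter_filter]
    congr 2
    ext j
    simp only [Finset.mem_filter, Finset.mem_univ, true_and] at hs ⊢
    constructor
    · exact fun h => h.2
    · rintro rfl
      exact ⟨hs, rfl⟩
  have hflip : Fintype.card {s : Message ℓ // s i0 = true}
      = Fintype.card {s : Message ℓ // s i0 = false} := by
    refine Fintype.card_congr ((Equiv.piCongrRight fun _ => Equiv.boolNot).subtypeEquiv ?_)
    simp [Equiv.boolNot]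
  have heq : Fintype.card {j // S.1 j i0 = true} = Fintype.card {j // S.1 j i0 = false} := by
    have h1 := hcard true
    rw [hflip, ← hcard false] at h1
    exact Nat.eq_of_mul_eq_mul_left (by positivity) h1
  let f : ∀ b : Bool, Fin (Fintype.card {j // S.1 j i0 = false}) ≃ {j // S.1 j i0 = b} := fun b =>
    Fintype.equivOfCardEq (by cases b <;> simp [heq])
  refine ⟨_, ((Equiv.sigmaEquivProd _ _).symm.trans (Equiv.sigmaCongrRight f)).trans
    (Equiv.sigmaFiberEquiv fun j => S.1 j i0), fun p hp => ?_⟩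
  have h1 : S.1 (f true p).1 i0 = S.1 (f false p).1 i0 := congrFun hp i0
  rw [(f true p).2, (f false p).2] at h1
  exact absurd h1 (by simp)

/-- The permutation that rotates the copy `false` and then swaps the two copies of the points at
which `ξ` is `false`. -/
def rotateSwap {h : ℕ} [NeZero h] (r : Fin h) (ξ : Fin h → Bool) :
    Equiv.Perm (Bool × Fin h) :=
  (Equiv.prodShear (Equiv.refl Bool) fun b => if b then Equiv.refl _ else Equiv.subRight r).trans
    (Function.Involutive.toPerm (fun z : Bool × Fin h => (z.1 == ξ z.2, z.2)) fun z => by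
      rcases z with ⟨b, p⟩
      cases b <;> cases h : ξ p <;> simp [h])

theorem rotateSwap_true {h : ℕ} [NeZero h] (r : Fin h) (ξ : Fin h → Bool) (p : Fin h) :
    rotateSwap r ξ (true, p) = (ξ p, p) := by
  change ((true == ξ p), p) = (ξ p, p)
  simp

theorem rotateSwap_false {h : ℕ} [NeZero h] (r : Fin h) (ξ : Fin h → Bool) (p : Fin h) :
    rotateSwap r ξ (false, p + r) = (!ξ p, p) := by
  change ((false == ξ (p + r - r)), p + r - r) = (!ξ p, p)
  simp

/-- Identifies random relabelling with the rotate-and-swap model: `π` places the weights on the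
pairs, after which the weights at `(true, p)` and `(false, p + r)` become partners in pair `p`. -/
theorem partMass_permute_rotateSwap {h : ℕ} [NeZero h] (S : BalancedPartition K ℓ)
    (e : Bool × Fin h ≃ Fin K) (r : Fin h) (ξ : Fin h → Bool) (π : Equiv.Perm (Fin K))
    (d : Fin K → ℝ) (s : Message ℓ) :
    partMass (S.permute (e.permCongr (rotateSwap r ξ) * π)) d s
      = pairedMass (fun b p => S.1 (e (b, p))) (fun p => d (π.symm (e (true, p))))
          (fun p => d (π.symm (e (false, p + r)))) ξ s := by
  rw [partMass, ← Equiv.sum_comp (e.trans π.symm), Fintype.sum_prod_type, Fintype.sum_bool,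
    pairedMass, Finset.sum_add_distrib]
  congr 1
  · refine Finset.sum_congr rfl fun p _ => ?_
    simp [BalancedPartition.permute, rotateSwap_true]
  · rw [← Equiv.sum_comp (Equiv.addRight r)]
    refine Finset.sum_congr rfl fun p _ => ?_
    simp [BalancedPartition.permute, rotateSwap_false]

/-- With constant probability a random balanced partition preserves, up to a constant factor, the
Euclidean norm of a vector of mean zero. -/
theorem card_le_sum_partMass_sq (hℓ : 1 ≤ ℓ) (hK : 0 < K) (d : Fin K → ℝ) (hd : ∑ j, d j = 0) :
    (Fintype.card (BalancedPartition K ℓ) : ℝ) / 30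
      ≤ ∑ S : BalancedPartition K ℓ,
        if (∑ j, d j ^ 2) / 8 ≤ ∑ s, partMass S d s ^ 2 then (1 : ℝ) else 0 := by
  classical
  let G : BalancedPartition K ℓ → ℝ := fun S =>
    if (∑ j, d j ^ 2) / 8 ≤ ∑ s, partMass S d s ^ 2 then (1 : ℝ) else 0
  have hS : ∀ S : BalancedPartition K ℓ,
      (Fintype.card (Equiv.Perm (Fin K)) : ℝ) / 30 ≤ ∑ π : Equiv.Perm (Fin K), G (S.permute π) := by
    intro S
    obtain ⟨h, e, he⟩ := exists_pairing hℓ S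
    have hcard : 2 * h = K := by simpa using Fintype.card_congr e
    have : NeZero h := ⟨by omega⟩
    have h1 : ∀ π : Equiv.Perm (Fin K), (h : ℝ) * 2 ^ h / 30
        ≤ ∑ r : Fin h, ∑ ξ : Fin h → Bool,
          G (S.permute (e.permCongr (rotateSwap r ξ) * π)) := by
      intro π
      have hsum : ∀ f : Fin K → ℝ, ∑ p, f (π.symm (e (true, p))) + ∑ p, f (π.symm (e (false, p)))
          = ∑ j, f j := by
        intro f
        rw [← Equiv.sum_comp (e.trans π.symm), Fintype.sum_prod_type, Fintype.sum_bool]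
        rfl
      have h2 := card_le_sum_rotated_pairedMass_sq (g := fun b p => S.1 (e (b, p))) he
        (fun p => d (π.symm (e (true, p)))) (fun p => d (π.symm (e (false, p))))
        ((hsum d).trans hd)
      rw [hsum fun j => d j ^ 2] at h2
      simpa only [G, partMass_permute_rotateSwap] using h2
    have h3 := Finset.sum_le_sum fun π (_ : π ∈ Finset.univ) => h1 π
    -- Left multiplication by a fixed permutation preserves the uniform law on permutations, so the
    -- extra rotation and swaps do not change the average over `π`.
    have h4 : ∑ π : Equiv.Perm (Fin K), ∑ r : Fin h, ∑ ξ : Fin h → Bool,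
          G (S.permute (e.permCongr (rotateSwap r ξ) * π))
        = h * 2 ^ h * ∑ π : Equiv.Perm (Fin K), G (S.permute π) := by
      rw [Finset.sum_comm]
      have h5 : ∀ r : Fin h, ∑ π : Equiv.Perm (Fin K), ∑ ξ : Fin h → Bool,
          G (S.permute (e.permCongr (rotateSwap r ξ) * π))
          = 2 ^ h * ∑ π : Equiv.Perm (Fin K), G (S.permute π) := by
        intro r
        rw [Finset.sum_comm]
        have h6 : ∀ ξ : Fin h → Bool, ∑ π : Equiv.Perm (Fin K),
            G (S.permute (e.permCongr (rotateSwap r ξ) * π))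
            = ∑ π : Equiv.Perm (Fin K), G (S.permute π) := fun ξ =>
          Equiv.sum_comp (Equiv.mulLeft (e.permCongr (rotateSwap r ξ))) fun π => G (S.permute π)
        rw [Finset.sum_congr rfl fun ξ _ => h6 ξ]
        simp
      rw [Finset.sum_congr rfl fun r _ => h5 r]
      simp
      ring
    rw [h4] at h3
    simp only [Finset.sum_const, Finset.card_univ, nsmul_eq_mul] at h3
    have h7 : 0 < (h : ℝ) * 2 ^ h := by
      have : 0 < h := Nat.pos_of_ne_zero (NeZero.ne h)
      positivity
    refine le_of_mul_le_mul_left (le_trans (le_of_eq ?_) h3) h7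
    ring
  have h1 := Finset.sum_le_sum fun S (_ : S ∈ Finset.univ) => hS S
  rw [Finset.sum_comm] at h1
  have h2 : ∀ π : Equiv.Perm (Fin K), ∑ S : BalancedPartition K ℓ, G (S.permute π) = ∑ S, G S :=
    fun π => Equiv.sum_comp (BalancedPartition.permuteEquiv π) G
  rw [Finset.sum_congr rfl fun π _ => h2 π] at h1
  simp only [Finset.sum_const, Finset.card_univ, nsmul_eq_mul] at h1
  have h3 : (0 : ℝ) < Fintype.card (Equiv.Perm (Fin K)) := by exact_mod_cast Fintype.card_pos
  refine le_of_mul_le_mul_left (le_trans (le_of_eq ?_) h1) h3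
  ring

end RandomPartition

/-! ### The uniformity test and its referee -/

section UniformityTest

variable {k ℓ n N K : ℕ}

theorem messages_partitionProtocol (hK : 2 ^ ℓ ∣ K) (F : Fin k → PMF (Fin K))
    (block : Fin n → Fin N)
    (decision : (Fin N → BalancedPartition K ℓ) → (Fin n → Message ℓ) → PMF Bool)
    (p : PMF (Fin k)) (u : Fin N → BalancedPartition K ℓ) :
    (partitionProtocol hK F block decision).messages p u
      = productPMF fun i => (p.bind F).map (u (block i)).1 := by
  have h := productPMF_bind (fun _ : Fin n => p) fun i x => (F x).map (u (block i)).1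
  refine h.trans ?_
  congr 1
  funext i
  rw [PMF.map_bind]

/-- The probability of a given part under the law `p`. -/
def partProb (p : PMF (Fin K)) (S : BalancedPartition K ℓ) (s : Message ℓ) : ℝ :=
  (p.map S.1 s).toReal

theorem partProb_nonneg (p : PMF (Fin K)) (S : BalancedPartition K ℓ) (s : Message ℓ) :
    0 ≤ partProb p S s := ENNReal.toReal_nonneg

theorem sum_partProb (p : PMF (Fin K)) (S : BalancedPartition K ℓ) : ∑ s, partProb p S s = 1 :=
  sum_toReal _

/-- Balance gives every part uniform mass exactly `2^(-ℓ)`, so centring the message law corresponds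
to centring `p` on the domain. -/
theorem partProb_sub (hK : 0 < K) (p : PMF (Fin K)) (S : BalancedPartition K ℓ) (s : Message ℓ) :
    partProb p S s - (Fintype.card (Message ℓ) : ℝ)⁻¹
      = partMass S (fun j => (p j).toReal - (K : ℝ)⁻¹) s := by
  have h1 : ∀ j, (if S.1 j = s then (p j).toReal - (K : ℝ)⁻¹ else 0)
      = (if S.1 j = s then (p j).toReal else 0) - (if S.1 j = s then (K : ℝ)⁻¹ else 0) := by
    intro j
    split_ifs <;> simp
  rw [partProb, toReal_map, partMass, Finset.sum_congr rfl fun j _ => h1 j,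
    Finset.sum_sub_distrib]
  congr 1
  have h2 : (2 : ℝ) ^ ℓ * (Finset.univ.filter fun j => S.1 j = s).card = K := by
    exact_mod_cast S.2 s
  rw [← Finset.sum_filter, Finset.sum_const, nsmul_eq_mul]
  have h3 : (K : ℝ) ≠ 0 := by positivity
  simp only [Fintype.card_pi, Fintype.card_bool, Finset.prod_const, Finset.card_univ,
    Fintype.card_fin]
  push_cast
  field_simp
  linarith

theorem sqDistUniform_partProb (hK : 0 < K) (p : PMF (Fin K)) (S : BalancedPartition K ℓ) :
    sqDistUniform (partProb p S) = ∑ s, partMass S (fun j => (p j).toReal - (K : ℝ)⁻¹) s ^ 2 :=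
  Finset.sum_congr rfl fun s _ => by rw [partProb_sub hK]

theorem toReal_output_partitionProtocol (hK : 2 ^ ℓ ∣ K) (F : Fin k → PMF (Fin K))
    (block : Fin n → Fin N)
    (decision : (Fin N → BalancedPartition K ℓ) → (Fin n → Message ℓ) → PMF Bool)
    (p : PMF (Fin k)) (b : Bool) :
    ((partitionProtocol hK F block decision).output p b).toReal
      = ∑ u : Fin N → BalancedPartition K ℓ,
        (Fintype.card (Fin N → BalancedPartition K ℓ) : ℝ)⁻¹
          * ∑ y : Fin n → Message ℓ, (∏ i, partProb (p.bind F) (u (block i)) (y i))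
            * (decision u y b).toReal := by
  have : Nonempty (BalancedPartition K ℓ) := nonempty_balancedPartition hK
  have h1 : (partitionProtocol hK F block decision).output p
      = (PMF.uniformOfFintype (Fin N → BalancedPartition K ℓ)).bind fun u =>
        ((partitionProtocol hK F block decision).messages p u).bind fun y => decision u y := rfl
  rw [h1, toReal_bind]
  refine Finset.sum_congr rfl fun u _ => ?_
  rw [messages_partitionProtocol, toReal_bind, PMF.uniformOfFintype_apply, ENNReal.toReal_inv,
    ENNReal.toReal_natCast]
  congr 1
  refine Finset.sum_congr rfl fun y _ => ?_
  rw [toReal_productPMF]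
  rfl

theorem toReal_true_add_toReal_false (μ : PMF Bool) : (μ true).toReal + (μ false).toReal = 1 := by
  rw [← sum_toReal μ, Fintype.sum_bool]

theorem toReal_pure_decide (q : Prop) [Decidable q] (b : Bool) :
    (PMF.pure (decide q) b).toReal = if (decide q) = b then (1 : ℝ) else 0 := by
  rw [PMF.pure_apply]
  by_cases h : decide q = b
  · simp [h]
  · simp [h, Ne.symm h]

/-- The probability that none of `N` independent random partitions lies in a set. -/
theorem sum_forall_eq_pow [Nonempty (BalancedPartition K ℓ)] (B : BalancedPartition K ℓ → Prop)
    [DecidablePred B] :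
    ∑ u : Fin N → BalancedPartition K ℓ,
        (Fintype.card (Fin N → BalancedPartition K ℓ) : ℝ)⁻¹
          * (if ∀ b, B (u b) then (1 : ℝ) else 0)
      = ((Fintype.card (BalancedPartition K ℓ) : ℝ)⁻¹ * ∑ S, if B S then (1 : ℝ) else 0) ^ N := by
  have h1 : ∀ u : Fin N → BalancedPartition K ℓ, (if ∀ b, B (u b) then (1 : ℝ) else 0)
      = ∏ b, if B (u b) then (1 : ℝ) else 0 := by
    intro u
    rw [Finset.prod_boole]
    simp
  rw [← Finset.mul_sum, Finset.sum_congr rfl fun u _ => h1 u,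
    sum_pi_prod fun (_ : Fin N) S => if B S then (1 : ℝ) else 0]
  simp [mul_pow]

/-- Testing uniformity on `K` points with random balanced partitions: there is a referee that works
for all channels into the `K` points. -/
theorem exists_uniformity_test (hℓ : 1 ≤ ℓ) (hK0 : 0 < K) (hK : 2 ^ ℓ ∣ K) {ε : ℝ} (hε : 0 < ε)
    (hε1 : ε ≤ 1) {m : ℕ} (hm : 8000 * (K / (√(2 ^ ℓ) * ε ^ 2)) ≤ m) :
    ∃ (block : Fin (100 * (m + m)) → Fin 100)
      (decision : (Fin 100 → BalancedPartition K ℓ) →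
        (Fin (100 * (m + m)) → Message ℓ) → PMF Bool),
      ∀ (k : ℕ) (F : Fin k → PMF (Fin K)) (p : PMF (Fin k)),
        ((∀ j, (p.bind F j).toReal = (K : ℝ)⁻¹) →
          1 - 1 / 12 < ((partitionProtocol hK F block decision).output p true).toReal) ∧
        (ε ^ 2 / K ≤ ∑ j, ((p.bind F j).toReal - (K : ℝ)⁻¹) ^ 2 →
          1 - 1 / 12 < ((partitionProtocol hK F block decision).output p false).toReal) := by
  classical
  have : Nonempty (BalancedPartition K ℓ) := nonempty_balancedPartition hK
  have hKr : (0 : ℝ) < K := by exact_mod_cast hK0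
  -- One hundred blocks, each split into the two groups of `m` players whose collisions are counted.
  let e : Fin (100 * (m + m)) ≃ Fin 100 × (Fin m ⊕ Fin m) := Fintype.equivOfCardEq (by simp)
  -- The squared distance that survives a good partition; the factor `8` is the loss in
  -- `card_le_sum_partMass_sq`.
  set g : ℝ := ε ^ 2 / (8 * K) with hgdef
  have hg : 0 < g := by positivity
  have hcardM : (Fintype.card (Message ℓ) : ℝ) = 2 ^ ℓ := by simp
  have hLK : (2 : ℝ) ^ ℓ ≤ K := by exact_mod_cast Nat.le_of_dvd hK0 hK
  have hmg : 1000 ≤ m * g * √(Fintype.card (Message ℓ)) := by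
    rw [hcardM, hgdef]
    have hs : 0 < √((2 : ℝ) ^ ℓ) := by positivity
    have h1 : 8000 * (K / (√(2 ^ ℓ) * ε ^ 2)) * (ε ^ 2 / (8 * K) * √(2 ^ ℓ))
        ≤ m * (ε ^ 2 / (8 * K) * √(2 ^ ℓ)) := mul_le_mul_of_nonneg_right hm (by positivity)
    have h2 : 8000 * (K / (√(2 ^ ℓ) * ε ^ 2)) * (ε ^ 2 / (8 * K) * √(2 ^ ℓ)) = 1000 := by
      field_simp
      norm_num
    linarith
  have hgL : g * Fintype.card (Message ℓ) ≤ 1 := by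
    rw [hcardM, hgdef, div_mul_eq_mul_div, div_le_one (by positivity)]
    nlinarith [pow_le_one₀ hε.le hε1 (n := 2), pow_pos (zero_lt_two (α := ℝ)) ℓ]
  -- Block `b` raises no alarm. The rule looks only at the messages, not at the partitions.
  let Q : (Fin (100 * (m + m)) → Message ℓ) → Fin 100 → Prop := fun y b =>
    collisionStat (fun c : Fin m ⊕ Fin m => y (e.symm (b, c))) ≤ (m : ℝ) ^ 2 * g / 2
  refine ⟨fun i => (e i).1, fun _ y => PMF.pure (decide (∀ b, Q y b)), fun k F p => ?_⟩
  set p' := p.bind F with hp'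
  set P := partitionProtocol hK F (fun i => (e i).1) fun _ y => PMF.pure (decide (∀ b, Q y b))
    with hP
  have hsum := toReal_true_add_toReal_false (P.output p)
  have hmarg : ∀ (u : Fin 100 → BalancedPartition K ℓ) (b : Fin 100)
      (f : (Fin m ⊕ Fin m → Message ℓ) → ℝ),
      ∑ y : Fin (100 * (m + m)) → Message ℓ, (∏ i, partProb p' (u (e i).1) (y i))
          * f (fun c => y (e.symm (b, c)))
        = ∑ x : Fin m ⊕ Fin m → Message ℓ, (∏ c, partProb p' (u b) (x c)) * f x := by
    intro u b f
    have h1 := sum_marginal (e := fun c : Fin m ⊕ Fin m => e.symm (b, c))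
      (fun c c' h => by simpa using h) (fun i => partProb p' (u (e i).1))
      (fun i => sum_partProb _ _) f
    simp only [Equiv.apply_symm_apply] at h1
    exact h1
  have hw : ∀ (u : Fin 100 → BalancedPartition K ℓ) (y : Fin (100 * (m + m)) → Message ℓ),
      0 ≤ ∏ i, partProb p' (u (e i).1) (y i) := fun u y =>
    Finset.prod_nonneg fun i _ => partProb_nonneg _ _ _
  have hcoin : (∑ _u : Fin 100 → BalancedPartition K ℓ,
      (Fintype.card (Fin 100 → BalancedPartition K ℓ) : ℝ)⁻¹) = 1 := by
    rw [Finset.sum_const, nsmul_eq_mul, Finset.card_univ]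
    exact mul_inv_cancel₀ (by simp)
  have hc0 : (0 : ℝ) ≤ (Fintype.card (Fin 100 → BalancedPartition K ℓ) : ℝ)⁻¹ := by positivity
  constructor
  · intro hunif
    -- Union bound over the blocks: `100 · 1/2000 = 1/20 < 1/12`.
    have hrej : (P.output p false).toReal ≤ 1 / 20 := by
      rw [hP, toReal_output_partitionProtocol]
      have h1 : ∀ u : Fin 100 → BalancedPartition K ℓ,
          ∑ y : Fin (100 * (m + m)) → Message ℓ, (∏ i, partProb p' (u (e i).1) (y i))
            * (PMF.pure (decide (∀ b, Q y b)) false).toReal ≤ 1 / 20 := by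
        intro u
        have h2 : ∀ y, (PMF.pure (decide (∀ b, Q y b)) false).toReal
            ≤ ∑ b, if (m : ℝ) ^ 2 * g / 2 <
              collisionStat (fun c : Fin m ⊕ Fin m => y (e.symm (b, c))) then (1 : ℝ) else 0 := by
          intro y
          rw [toReal_pure_decide]
          have h0 : ∀ b, (0 : ℝ) ≤ if (m : ℝ) ^ 2 * g / 2 <
              collisionStat (fun c : Fin m ⊕ Fin m => y (e.symm (b, c))) then (1 : ℝ) else 0 :=
            fun b => by split_ifs <;> norm_num
          split_ifs with hq
          · simp only [decide_eq_false_iff_not, not_forall, Q, not_le] at hq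
            obtain ⟨b, hb⟩ := hq
            refine le_trans (le_of_eq ?_)
              (Finset.single_le_sum (fun b _ => h0 b) (Finset.mem_univ b))
            rw [if_pos hb]
          · exact Finset.sum_nonneg fun b _ => h0 b
        refine (Finset.sum_le_sum fun y _ => mul_le_mul_of_nonneg_left (h2 y) (hw u y)).trans ?_
        simp_rw [Finset.mul_sum]
        rw [Finset.sum_comm]
        have h3 : ∀ b : Fin 100, ∑ y : Fin (100 * (m + m)) → Message ℓ,
            (∏ i, partProb p' (u (e i).1) (y i)) * (if (m : ℝ) ^ 2 * g / 2 <
              collisionStat (fun c : Fin m ⊕ Fin m => y (e.symm (b, c))) then (1 : ℝ) else 0)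
            ≤ 1 / 2000 := by
          intro b
          rw [hmarg u b fun x => if (m : ℝ) ^ 2 * g / 2 < collisionStat x then (1 : ℝ) else 0]
          have h4 := collisionStat_false_alarm hg hmg (partProb p' (u b)) (sum_partProb _ _)
            (partProb_nonneg _ _) (by
              rw [sqDistUniform_partProb hK0]
              simp [hunif, partMass])
          simpa only [mul_ite, mul_one, mul_zero] using h4
        refine (Finset.sum_le_sum fun b _ => h3 b).trans ?_
        simp
        norm_num
      refine (Finset.sum_le_sum fun u _ => mul_le_mul_of_nonneg_left (h1 u) hc0).trans ?_
      rw [← Finset.sum_mul, hcoin, one_mul]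
    linarith
  · intro hfar
    let d : Fin K → ℝ := fun j => (p' j).toReal - (K : ℝ)⁻¹
    let Good : BalancedPartition K ℓ → Prop := fun S =>
      (∑ j, d j ^ 2) / 8 ≤ ∑ s, partMass S d s ^ 2
    -- Acceptance requires that all partitions be bad, with probability at most `(29/30)^100 ≤
    -- 1/25`, or that a good block miss, with probability at most `1/40`. The sum is below `1/12`.
    have hacc : (P.output p true).toReal ≤ 1 / 40 + 1 / 25 := by
      rw [hP, toReal_output_partitionProtocol]
      have h1 : ∀ u : Fin 100 → BalancedPartition K ℓ,
          ∑ y : Fin (100 * (m + m)) → Message ℓ, (∏ i, partProb p' (u (e i).1) (y i))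
            * (PMF.pure (decide (∀ b, Q y b)) true).toReal
          ≤ 1 / 40 + if ∀ b, ¬ Good (u b) then (1 : ℝ) else 0 := by
        intro u
        split_ifs with hbad
        · have h2 : ∑ y : Fin (100 * (m + m)) → Message ℓ,
              ∏ i, partProb p' (u (e i).1) (y i) = 1 := by
            rw [sum_pi_prod fun i a => partProb p' (u (e i).1) a]
            simp [sum_partProb]
          refine le_trans (Finset.sum_le_sum fun y _ => mul_le_of_le_one_right (hw u y) ?_) ?_
          · rw [toReal_pure_decide]
            split_ifs <;> norm_num
          · rw [h2]
            norm_num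
        · push Not at hbad
          obtain ⟨b, hb⟩ := hbad
          rw [add_zero]
          have h2 : ∀ y, (PMF.pure (decide (∀ b, Q y b)) true).toReal
              ≤ if collisionStat (fun c : Fin m ⊕ Fin m => y (e.symm (b, c)))
                ≤ (m : ℝ) ^ 2 * g / 2 then (1 : ℝ) else 0 := by
            intro y
            rw [toReal_pure_decide]
            split_ifs with hq hc hc
            · exact le_rfl
            · exact absurd ((of_decide_eq_true hq) b) hc
            · exact zero_le_one
            · exact le_rfl
          refine (Finset.sum_le_sum fun y _ => mul_le_mul_of_nonneg_left (h2 y) (hw u y)).trans ?_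
          rw [hmarg u b fun x => if collisionStat x ≤ (m : ℝ) ^ 2 * g / 2 then (1 : ℝ) else 0]
          have h4 := collisionStat_missed_detection hg hmg hgL (partProb p' (u b))
            (sum_partProb _ _) (partProb_nonneg _ _) (by
              rw [sqDistUniform_partProb hK0]
              refine le_trans ?_ hb
              have : g = ε ^ 2 / K / 8 := by
                rw [hgdef]
                field_simp
              rw [this]
              exact div_le_div_of_nonneg_right hfar (by norm_num))
          simpa only [mul_ite, mul_one, mul_zero] using h4
      refine (Finset.sum_le_sum fun u _ => mul_le_mul_of_nonneg_left (h1 u) hc0).trans ?_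
      simp_rw [mul_add]
      rw [Finset.sum_add_distrib, ← Finset.sum_mul, hcoin, one_mul,
        sum_forall_eq_pow (N := 100) fun S => ¬ Good S]
      have hgood := card_le_sum_partMass_sq hℓ hK0 d (by
        simp only [d, Finset.sum_sub_distrib, sum_toReal]
        simp [hKr.ne'])
      have hcard : (0 : ℝ) < Fintype.card (BalancedPartition K ℓ) := by
        exact_mod_cast Fintype.card_pos
      have hbad : (Fintype.card (BalancedPartition K ℓ) : ℝ)⁻¹
          * (∑ S, if ¬ Good S then (1 : ℝ) else 0) ≤ 29 / 30 := by
        have h5 : (∑ S, if ¬ Good S then (1 : ℝ) else 0) + (∑ S, if Good S then (1 : ℝ) else 0)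
            = Fintype.card (BalancedPartition K ℓ) := by
          rw [← Finset.sum_add_distrib]
          have : ∀ S, ((if ¬ Good S then (1 : ℝ) else 0) + if Good S then (1 : ℝ) else 0) = 1 := by
            intro S
            by_cases h : Good S <;> simp [h]
          rw [Finset.sum_congr rfl fun S _ => this S]
          simp
        rw [inv_mul_le_iff₀ hcard]
        have h6 : (Fintype.card (BalancedPartition K ℓ) : ℝ) / 30
            ≤ ∑ S, if Good S then (1 : ℝ) else 0 := hgood
        linarith
      have h7 : (0 : ℝ) ≤ (Fintype.card (BalancedPartition K ℓ) : ℝ)⁻¹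
          * (∑ S, if ¬ Good S then (1 : ℝ) else 0) :=
        mul_nonneg (by positivity) (Finset.sum_nonneg fun S _ => by split_ifs <;> norm_num)
      have h8 := pow_le_pow_left₀ h7 hbad 100
      have h9 : ((29 : ℝ) / 30) ^ 100 ≤ 1 / 25 := by norm_num
      linarith
    linarith

end UniformityTest

/-! ### Reduction from identity to uniformity -/

section IdentityToUniformity

variable {k K : ℕ}

/-- Every distribution on `k` points with `2 * k ≤ K` is mapped by some channel to the uniform
distribution on `K` points, in such a way that total variation distances are preserved up to a
constant factor. -/
theorem exists_uniformizing_channel (hK : 2 * k ≤ K) (q : PMF (Fin k)) :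
    ∃ F : Fin k → PMF (Fin K), (∀ j, (q.bind F j).toReal = (K : ℝ)⁻¹) ∧
      ∀ p : PMF (Fin k), tvDist p q = ∑ j, |(p.bind F j).toReal - (K : ℝ)⁻¹| := by
  classical
  obtain ⟨i0, -⟩ := q.support_nonempty
  have hK0 : 0 < K := by have := i0.pos; omega
  have hKr : (0 : ℝ) < K := by exact_mod_cast hK0
  let w : Fin k → ℝ := fun i => (q i).toReal
  have hw0 : ∀ i, 0 ≤ w i := fun i => ENNReal.toReal_nonneg
  have hw1 : ∑ i, w i = 1 := sum_toReal q
  -- Point `i` is to own at least `K w i / 2` cells and at least one; these requests total at most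
  -- `K/2 + k ≤ K`. Leftover cells go to `i0`.
  let m : Fin k → ℕ := fun i => ⌊K * w i / 2⌋₊ + 1
  have hm : Fintype.card (Σ i, Fin (m i)) ≤ Fintype.card (Fin K) := by
    rw [Fintype.card_sigma, Fintype.card_fin, ← Nat.cast_le (α := ℝ)]
    simp only [Fintype.card_fin, Nat.cast_sum]
    have h1 : ∀ i, (m i : ℝ) ≤ K * w i / 2 + 1 := fun i => by
      simp only [m, Nat.cast_add, Nat.cast_one]
      linarith [Nat.floor_le (by have := hw0 i; positivity : 0 ≤ K * w i / 2)]
    refine (Finset.sum_le_sum fun i _ => h1 i).trans ?_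
    rw [Finset.sum_add_distrib, ← Finset.sum_div, ← Finset.mul_sum, hw1]
    simp only [Finset.sum_const, Finset.card_univ, Fintype.card_fin, nsmul_eq_mul]
    have h2 : (2 : ℝ) * k ≤ K := by exact_mod_cast hK
    linarith
  obtain ⟨f⟩ := Function.Embedding.nonempty_of_card_le hm
  let o : Fin K → Fin k := Function.extend f Sigma.fst fun _ => i0
  have ho : ∀ z, o (f z) = z.1 := fun z => f.injective.extend_apply _ _ z
  let c : Fin k → ℝ := fun i => (Finset.univ.filter fun j => o j = i).card
  have hcm : ∀ i, (m i : ℝ) ≤ c i := by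
    intro i
    simp only [c, Nat.cast_le]
    have h1 := Finset.card_le_card_of_injOn (s := (Finset.univ : Finset (Fin (m i))))
      (t := Finset.univ.filter fun j => o j = i) (fun a => f ⟨i, a⟩)
      (fun a _ => by simp [ho]) (fun a _ b _ hab => by simpa using hab)
    simpa using h1
  have hc0 : ∀ i, 0 < c i := fun i =>
    lt_of_lt_of_le (by simp only [m]; positivity) (hcm i)
  have hcw : ∀ i, K * w i / 2 ≤ c i := fun i =>
    (Nat.lt_floor_add_one _).le.trans (le_trans (by simp [m]) (hcm i))
  have hfib : ∀ φ : Fin k → ℝ, ∑ j, φ (o j) / c (o j) = ∑ i, φ i := by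
    intro φ
    rw [← Finset.sum_fiberwise (s := Finset.univ) (g := o)]
    refine Finset.sum_congr rfl fun i _ => ?_
    have h1 : ∀ j ∈ Finset.univ.filter fun j => o j = i, φ (o j) / c (o j) = φ i / c i := by
      intro j hj
      rw [(Finset.mem_filter.1 hj).2]
    rw [Finset.sum_congr rfl h1, Finset.sum_const, nsmul_eq_mul]
    exact mul_div_cancel₀ _ (hc0 i).ne'
  -- With probability `1/2` a point moves to a uniform cell of its own. The other half is spread by
  -- a density independent of `i`, chosen to make the image of `q` uniform; it is nonnegative
  -- because `c i ≥ K w i / 2`. Being common to all points, it cancels in differences.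
  let R : Fin k → Fin K → ℝ := fun i j =>
    (if o j = i then (1 / 2) / c (o j) else 0) + ((K : ℝ)⁻¹ - w (o j) / c (o j) / 2)
  have hR0 : ∀ i j, 0 ≤ R i j := by
    intro i j
    have h1 : w (o j) / c (o j) / 2 ≤ (K : ℝ)⁻¹ := by
      rw [div_div, div_le_iff₀ (by have := hc0 (o j); positivity), inv_mul_eq_div,
        le_div_iff₀ hKr]
      linarith [hcw (o j)]
    have h2 : 0 ≤ if o j = i then (1 / 2) / c (o j) else 0 := by
      split_ifs
      · have := hc0 (o j)
        positivity
      · exact le_rfl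
    simp only [R]
    linarith
  have hR1 : ∀ i, ∑ j, R i j = 1 := by
    intro i
    have h1 : ∀ j, (if o j = i then (1 / 2) / c (o j) else 0)
        = (if o j = i then (1 / 2 : ℝ) else 0) / c (o j) := fun j => by
      split_ifs <;> simp
    simp only [R]
    rw [Finset.sum_add_distrib, Finset.sum_sub_distrib, Finset.sum_congr rfl fun j _ => h1 j,
      hfib fun i' => if i' = i then 1 / 2 else 0, ← Finset.sum_div, hfib w, hw1]
    simp [hKr.ne']
  let F : Fin k → PMF (Fin K) := fun i =>
    PMF.ofFintype (fun j => ENNReal.ofReal (R i j)) (by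
      rw [← ENNReal.ofReal_sum_of_nonneg fun j _ => hR0 i j, hR1, ENNReal.ofReal_one])
  have hF : ∀ (p : PMF (Fin k)) (j : Fin K), (p.bind F j).toReal - (K : ℝ)⁻¹
      = ((p (o j)).toReal - w (o j)) / c (o j) / 2 := by
    intro p j
    rw [toReal_bind]
    have h1 : ∀ i, (p i).toReal * (F i j).toReal
        = (if o j = i then (p (o j)).toReal * ((1 / 2) / c (o j)) else 0)
          + (p i).toReal * ((K : ℝ)⁻¹ - w (o j) / c (o j) / 2) := by
      intro i
      rw [PMF.ofFintype_apply, ENNReal.toReal_ofReal (hR0 i j)]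
      simp only [R]
      split_ifs with h
      · rw [h]; ring
      · ring
    rw [Finset.sum_congr rfl fun i _ => h1 i, Finset.sum_add_distrib, ← Finset.sum_mul,
      sum_toReal]
    simp only [Finset.sum_ite_eq, Finset.mem_univ, if_true]
    ring
  refine ⟨F, fun j => ?_, fun p => ?_⟩
  · have h1 := hF q j
    rw [sub_self, zero_div, zero_div] at h1
    linarith
  · have h1 : ∀ j, |(p.bind F j).toReal - (K : ℝ)⁻¹|
        = |(p (o j)).toReal - w (o j)| / c (o j) / 2 := by
      intro j
      rw [hF, abs_div, abs_div, abs_of_pos (hc0 (o j)), abs_two]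
    rw [Finset.sum_congr rfl fun j _ => h1 j, ← Finset.sum_div,
      hfib fun i => |(p i).toReal - w i|, tvDist]
    ring

/-- Cauchy–Schwarz, passing from L1 farness to the L2 farness that collisions detect. -/
theorem sq_div_le_sum_sq (hK : 0 < K) (d : Fin K → ℝ) {ε : ℝ} (hε : 0 ≤ ε)
    (hd : ε ≤ ∑ j, |d j|) : ε ^ 2 / K ≤ ∑ j, d j ^ 2 := by
  rw [div_le_iff₀ (by exact_mod_cast hK)]
  have h1 := sq_sum_le_card_mul_sum_sq (s := (Finset.univ : Finset (Fin K))) (f := fun j => |d j|)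
  simp only [sq_abs, Finset.card_univ, Fintype.card_fin] at h1
  have h2 := pow_le_pow_left₀ hε hd 2
  linarith

end IdentityToUniformity

/-! ### Degenerate parameters and longer messages -/

theorem tvDist_le_one {k : ℕ} (p q : PMF (Fin k)) : tvDist p q ≤ 1 := by
  have h1 : ∀ x, |(p x).toReal - (q x).toReal| ≤ (p x).toReal + (q x).toReal := fun x =>
    (abs_sub _ _).trans_eq (by
      rw [abs_of_nonneg ENNReal.toReal_nonneg, abs_of_nonneg ENNReal.toReal_nonneg])
  have h2 := Finset.sum_le_sum fun x (_ : x ∈ Finset.univ) => h1 x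
  rw [Finset.sum_add_distrib, sum_toReal, sum_toReal] at h2
  rw [tvDist]
  linarith

namespace PublicCoinProtocol

theorem isIdentityTest_of_decision_eq_pure {k ℓ n : ℕ} (P : PublicCoinProtocol k ℓ n)
    (hP : ∀ u y, P.decision u y = PMF.pure true) {q : PMF (Fin k)} {ε δ : ℝ} (hδ : 0 < δ)
    (hq : ∀ p, tvDist p q ≤ ε) : P.IsIdentityTest q ε δ := by
  intro p
  refine ⟨fun _ => ?_, fun h => absurd (hq p) (not_le.2 h)⟩
  have : P.output p = PMF.pure true := by simp [output, hP]
  rw [this]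
  simp [hδ]

/-- The protocol with longer messages in which the messages are encoded by `ι` and decoded by
`ι'`. -/
def encode {k ℓ ℓ' n : ℕ} (P : PublicCoinProtocol k ℓ' n) (ι : Message ℓ' → Message ℓ)
    (ι' : Message ℓ → Message ℓ') : PublicCoinProtocol k ℓ n where
  Ω := P.Ω
  coin := P.coin
  channel u i x := (P.channel u i x).map ι
  decision u y := P.decision u fun i => ι' (y i)

/-- The injective encoding is undone by the referee before deciding, so surplus message bits are
harmless. -/
theorem output_encode {k ℓ ℓ' n : ℕ} (P : PublicCoinProtocol k ℓ' n) {ι : Message ℓ' → Message ℓ}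
    {ι' : Message ℓ → Message ℓ'} (h : Function.LeftInverse ι' ι) (p : PMF (Fin k)) :
    (P.encode ι ι').output p = P.output p := by
  have hpure : ∀ z : Fin n → Message ℓ, productPMF (fun i => PMF.pure (z i)) = PMF.pure z := by
    intro z
    ext y
    rw [productPMF_apply]
    simp only [PMF.pure_apply, Finset.prod_boole, funext_iff, Finset.mem_univ, true_imp_iff]
  have hmap : ∀ μ : Fin n → PMF (Message ℓ'),
      productPMF (fun i => (μ i).map ι) = (productPMF μ).map fun x i => ι (x i) := by
    intro μ
    have h1 := productPMF_bind μ fun _ a => PMF.pure (ι a)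
    rw [← PMF.bind_pure_comp]
    simp only [← PMF.bind_pure_comp]
    refine h1.symm.trans ?_
    congr 1
    funext x
    exact hpure _
  have hmes : ∀ u : P.Ω, (P.encode ι ι').messages p u = (P.messages p u).map fun x i => ι (x i) := by
    intro u
    simp only [messages, encode, hmap, PMF.map_bind]
  have h2 : (P.encode ι ι').output p
      = P.coin.bind fun u => ((P.encode ι ι').messages p u).bind fun y =>
        P.decision u fun i => ι' (y i) := rfl
  rw [h2, output]
  congr 1
  funext u
  rw [hmes, PMF.bind_map]
  congr 1
  funext x
  simp [h _]

end PublicCoinProtocol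

/-! ### Choice of parameters and assembly -/

theorem rpow_half_eq_sqrt (ℓ : ℕ) : (2 : ℝ) ^ ((ℓ : ℝ) / 2) = √(2 ^ ℓ) := by
  rw [Real.sqrt_eq_rpow, ← Real.rpow_natCast, ← Real.rpow_mul (by norm_num)]
  congr 1
  ring

theorem exists_sample_size {K ℓ : ℕ} (hK0 : 0 < K) (hK : 2 ^ ℓ ∣ K) {ε : ℝ} (hε : 0 < ε)
    (hε1 : ε ≤ 1) :
    ∃ m : ℕ, 8000 * (K / (√(2 ^ ℓ) * ε ^ 2)) ≤ m ∧
      ((100 * (m + m) : ℕ) : ℝ) ≤ 2000000 * (K / (√(2 ^ ℓ) * ε ^ 2)) := by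
  have hLK : (2 : ℝ) ^ ℓ ≤ K := by exact_mod_cast Nat.le_of_dvd hK0 hK
  have hs : 0 < √((2 : ℝ) ^ ℓ) := by positivity
  -- This lower bound lets the target itself absorb the rounding up in the ceiling.
  have hX : 1 ≤ K / (√(2 ^ ℓ) * ε ^ 2) := by
    rw [one_le_div (by positivity)]
    have h1 : √((2 : ℝ) ^ ℓ) ≤ 2 ^ ℓ := by
      have h2 : (1 : ℝ) ≤ 2 ^ ℓ := one_le_pow₀ (by norm_num)
      exact Real.sqrt_le_iff.2 ⟨by positivity, by nlinarith⟩
    nlinarith [pow_le_one₀ hε.le hε1 (n := 2), sq_nonneg ε]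
  refine ⟨⌈8000 * (K / (√(2 ^ ℓ) * ε ^ 2))⌉₊, Nat.le_ceil _, ?_⟩
  have h1 := (Nat.ceil_lt_add_one
    (by positivity : 0 ≤ 8000 * (K / (√(2 ^ ℓ) * ε ^ 2)))).le
  push_cast
  linarith

theorem exists_partition_identity_test (k ℓ : ℕ) (ε : ℝ) (hℓ : 1 ≤ ℓ) (hℓk : ℓ ≤ Nat.clog 2 k)
    (hε : 0 < ε) :
    ∃ n : ℕ, (n : ℝ) ≤ 10 ^ 7 * (k / ((2 : ℝ) ^ ((ℓ : ℝ) / 2) * ε ^ 2)) ∧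
      ∀ q : PMF (Fin k),
        ∃ (N K : ℕ) (hK : 2 ^ ℓ ∣ K) (F : Fin k → PMF (Fin K)) (block : Fin n → Fin N)
          (decision : (Fin N → BalancedPartition K ℓ) → (Fin n → Message ℓ) → PMF Bool),
          (N : ℝ) ≤ 10 ^ 7 ∧ (K : ℝ) ≤ 10 ^ 7 * k ∧
          (partitionProtocol hK F block decision).IsIdentityTest q ε (1 / 12) := by
  have hk : 1 < k := by
    by_contra h
    rw [Nat.clog_of_right_le_one (not_lt.1 h)] at hℓk
    omega
  have hLk : 2 ^ ℓ ≤ 2 * k := by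
    have h1 := Nat.pow_pred_clog_lt_self (b := 2) (by norm_num) hk
    have h2 : 2 ^ ℓ ≤ 2 ^ Nat.clog 2 k := Nat.pow_le_pow_right (by norm_num) hℓk
    have h3 : 2 ^ Nat.clog 2 k = 2 * 2 ^ (Nat.clog 2 k).pred := by
      rw [← pow_succ']
      congr 1
      exact (Nat.succ_pred_eq_of_pos (hℓ.trans hℓk)).symm
    omega
  have hkr : (0 : ℝ) < k := by positivity
  -- The least multiple of `2^ℓ` exceeding `2k`; it is at most `2k + 2^ℓ ≤ 4k`, where `ℓ ≤ ⌈log₂ k⌉`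
  -- enters.
  let K : ℕ := 2 ^ ℓ * (2 * k / 2 ^ ℓ + 1)
  have hKd : 2 ^ ℓ ∣ K := Dvd.intro _ rfl
  have hKl : 2 * k ≤ K := by
    have := Nat.lt_mul_div_succ (2 * k) (by positivity : 0 < 2 ^ ℓ)
    exact this.le
  have hKu : K ≤ 4 * k := by
    have := Nat.mul_div_le (2 * k) (2 ^ ℓ)
    simp only [K, mul_add, mul_one]
    omega
  have hK0 : 0 < K := by omega
  have hKr : (K : ℝ) ≤ 4 * k := by exact_mod_cast hKu
  rw [rpow_half_eq_sqrt]
  rcases le_total ε 1 with hε1 | hε1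
  · obtain ⟨m, hm, hn⟩ := exists_sample_size hK0 hKd hε hε1
    obtain ⟨block, decision, htest⟩ := exists_uniformity_test hℓ hK0 hKd hε hε1 hm
    refine ⟨_, hn.trans ?_, fun q => ?_⟩
    · have h1 : (K : ℝ) / (√(2 ^ ℓ) * ε ^ 2) ≤ 4 * (k / (√(2 ^ ℓ) * ε ^ 2)) := by
        rw [← mul_div_assoc]
        gcongr
      have h2 : 0 ≤ (k : ℝ) / (√(2 ^ ℓ) * ε ^ 2) := by positivity
      linarith
    · obtain ⟨F, hF, hF'⟩ := exists_uniformizing_channel hKl q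
      refine ⟨100, K, hKd, F, block, decision, by norm_num, by linarith, fun p => ⟨?_, fun h => ?_⟩⟩
      · rintro rfl
        exact (htest k F p).1 hF
      · rw [hF' p] at h
        exact (htest k F p).2 (sq_div_le_sum_sq hK0 _ hε.le h.le)
  -- For `ε ≥ 1` no law is farther than `ε`, so accepting without any players suffices.
  · refine ⟨0, by simp; positivity, fun q => ?_⟩
    refine ⟨0, K, hKd, fun _ => PMF.pure ⟨0, hK0⟩, Fin.elim0, fun _ _ => PMF.pure true, by simp,
      by linarith, ?_⟩
    exact PublicCoinProtocol.isIdentityTest_of_decision_eq_pure _ (fun _ _ => rfl) (by norm_num)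
      fun p => (tvDist_le_one p q).trans hε1

theorem exists_partition_uniformity_test (k ℓ : ℕ) [NeZero k] (ε : ℝ) (hk : 2 ^ ℓ ∣ k)
    (hℓ : 1 ≤ ℓ) (hε : 0 < ε) :
    ∃ n : ℕ, (n : ℝ) ≤ 10 ^ 7 * (k / ((2 : ℝ) ^ ((ℓ : ℝ) / 2) * ε ^ 2)) ∧
      ∃ (N : ℕ) (block : Fin n → Fin N)
        (decision : (Fin N → BalancedPartition k ℓ) → (Fin n → Message ℓ) → PMF Bool),
        (N : ℝ) ≤ 10 ^ 7 ∧
        (partitionProtocol hk PMF.pure block decision).IsIdentityTest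
          (PMF.uniformOfFintype (Fin k)) ε (1 / 12) := by
  have hk0 : 0 < k := Nat.pos_of_ne_zero (NeZero.ne k)
  have hu : ∀ j, (PMF.uniformOfFintype (Fin k) j).toReal = (k : ℝ)⁻¹ := by simp
  rw [rpow_half_eq_sqrt]
  rcases le_total ε 1 with hε1 | hε1
  · obtain ⟨m, hm, hn⟩ := exists_sample_size hk0 hk hε hε1
    obtain ⟨block, decision, htest⟩ := exists_uniformity_test hℓ hk0 hk hε hε1 hm
    refine ⟨_, hn.trans ?_, 100, block, decision, by norm_num, fun p => ⟨?_, fun h => ?_⟩⟩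
    · exact mul_le_mul_of_nonneg_right (by norm_num) (by positivity)
    · rintro rfl
      refine (htest k PMF.pure _).1 fun j => ?_
      rw [PMF.bind_pure, hu]
    · refine (htest k PMF.pure p).2 (sq_div_le_sum_sq hk0 _ hε.le ?_)
      rw [PMF.bind_pure]
      simp only [tvDist, hu] at h
      linarith
  · refine ⟨0, by simp; positivity, 0, Fin.elim0, fun _ _ => PMF.pure true, by simp, ?_⟩
    exact PublicCoinProtocol.isIdentityTest_of_decision_eq_pure _ (fun _ _ => rfl) (by norm_num)
      fun p => (tvDist_le_one p _).trans hε1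

theorem exists_identity_test (k ℓ : ℕ) (ε : ℝ) (hk : 1 ≤ k) (hℓ : 1 ≤ ℓ) (hε : 0 < ε) :
    ∃ n : ℕ,
      (n : ℝ) ≤ 10 ^ 7 * (k / (min ((2 : ℝ) ^ ((ℓ : ℝ) / 2)) (Real.sqrt k) * ε ^ 2)) ∧
      ∀ q : PMF (Fin k), ∃ P : PublicCoinProtocol k ℓ n, P.IsIdentityTest q ε (1 / 12) := by
  rcases hk.eq_or_lt with rfl | hk1
  -- On one point all laws coincide. This case is separate because `Nat.clog 2 1 = 0` leaves no
  -- admissible message length.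
  · refine ⟨0, by simp; positivity, fun q => ⟨⟨Unit, PMF.pure (), fun _ => Fin.elim0,
      fun _ _ => PMF.pure true⟩, ?_⟩⟩
    refine PublicCoinProtocol.isIdentityTest_of_decision_eq_pure _ (fun _ _ => rfl) (by norm_num)
      fun p => ?_
    have hp := sum_toReal p
    have hq := sum_toReal q
    simp only [Finset.univ_unique, Finset.sum_singleton] at hp hq
    simp [tvDist] at *
    rw [hp, hq]
    simpa using hε.le
  · have hc : 1 ≤ Nat.clog 2 k := Nat.clog_pos (by norm_num) hk1
    -- Bits beyond `⌈log₂ k⌉` are not used; at the cap, `2^(ℓ'/2) ≥ √k`, which accounts for the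
    -- minimum in the bound.
    let ℓ' : ℕ := min ℓ (Nat.clog 2 k)
    obtain ⟨n, hn, htest⟩ := exists_partition_identity_test k ℓ' ε (le_min hℓ hc)
      (min_le_right _ _) hε
    have hkr : (0 : ℝ) < k := by positivity
    refine ⟨n, hn.trans ?_, fun q => ?_⟩
    · have h1 : min ((2 : ℝ) ^ ((ℓ : ℝ) / 2)) (Real.sqrt k) ≤ (2 : ℝ) ^ ((ℓ' : ℝ) / 2) := by
        rcases min_choice ℓ (Nat.clog 2 k) with h | h
        · simp only [ℓ', h]
          exact min_le_left _ _
        · refine (min_le_right _ _).trans ?_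
          rw [rpow_half_eq_sqrt]
          simp only [ℓ', h]
          exact Real.sqrt_le_sqrt (by exact_mod_cast Nat.le_pow_clog (by norm_num) k)
      have h2 : 0 < min ((2 : ℝ) ^ ((ℓ : ℝ) / 2)) (Real.sqrt k) :=
        lt_min (by positivity) (Real.sqrt_pos.2 hkr)
      gcongr
    · obtain ⟨N, K, hK, F, block, decision, -, -, ht⟩ := htest q
      have hle : Fintype.card (Message ℓ') ≤ Fintype.card (Message ℓ) := by
        simpa using Nat.pow_le_pow_right (n := 2) (by norm_num) (min_le_left ℓ (Nat.clog 2 k))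
      obtain ⟨ι⟩ := Function.Embedding.nonempty_of_card_le hle
      refine ⟨(partitionProtocol hK F block decision).encode ι (Function.invFun ι), fun p => ?_⟩
      rw [PublicCoinProtocol.output_encode _ (Function.leftInverse_invFun ι.injective)]
      exact ht p

end DistTest

end

theorem mainTheorem1 :
    ∃ C : ℝ, 0 < C ∧
      -- identity testing with at most `⌈log₂ k⌉` bits, by reporting parts of random partitions
      (∀ (k ℓ : ℕ) (ε : ℝ), 1 ≤ ℓ → ℓ ≤ Nat.clog 2 k → 0 < ε →
        ∃ n : ℕ, (n : ℝ) ≤ C * (k / ((2 : ℝ) ^ ((ℓ : ℝ) / 2) * ε ^ 2)) ∧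
          ∀ q : PMF (Fin k),
            ∃ (N K : ℕ) (hK : 2 ^ ℓ ∣ K) (F : Fin k → PMF (Fin K)) (block : Fin n → Fin N)
              (decision : (Fin N → DistTest.BalancedPartition K ℓ) →
                (Fin n → DistTest.Message ℓ) → PMF Bool),
              (N : ℝ) ≤ C ∧ (K : ℝ) ≤ C * k ∧
              (DistTest.partitionProtocol hK F block decision).IsIdentityTest q ε (1 / 12)) ∧
      -- if `q` is uniform and `2 ^ ℓ` divides `k`, the domain itself is partitioned
      (∀ (k ℓ : ℕ) [NeZero k] (ε : ℝ) (hk : 2 ^ ℓ ∣ k), 1 ≤ ℓ → 0 < ε →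
        ∃ n : ℕ, (n : ℝ) ≤ C * (k / ((2 : ℝ) ^ ((ℓ : ℝ) / 2) * ε ^ 2)) ∧
          ∃ (N : ℕ) (block : Fin n → Fin N)
            (decision : (Fin N → DistTest.BalancedPartition k ℓ) →
              (Fin n → DistTest.Message ℓ) → PMF Bool),
            (N : ℝ) ≤ C ∧
            (DistTest.partitionProtocol hk PMF.pure block decision).IsIdentityTest
              (PMF.uniformOfFintype (Fin k)) ε (1 / 12)) ∧
      -- identity testing with any number of bits
      (∀ (k ℓ : ℕ) (ε : ℝ), 1 ≤ k → 1 ≤ ℓ → 0 < ε →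
        ∃ n : ℕ,
          (n : ℝ) ≤ C * (k / (min ((2 : ℝ) ^ ((ℓ : ℝ) / 2)) (Real.sqrt k) * ε ^ 2)) ∧
          ∀ q : PMF (Fin k),
            ∃ P : DistTest.PublicCoinProtocol k ℓ n, P.IsIdentityTest q ε (1 / 12)) :=
  ⟨10 ^ 7, by norm_num, DistTest.exists_partition_identity_test,
    fun k ℓ _ ε hk => DistTest.exists_partition_uniformity_test k ℓ ε hk,
    DistTest.exists_identity_test⟩
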